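/- **Setting.** Let $\Omega\subset\mathbb R^2$ be a non-empty bounded open set, $\Gamma\subseteq\partial\Omega$, and let $D_{f,1},\dots,D_{f,F}$ be finitely many fractures: $C^1$ arcs, parametrized by arc length, whose interiors lie in $\Omega$; $\nabla_f$ is the derivative along a fracture. For $i=1,\dots,N$ (continua) let $c_i,\kappa_i$ be measurable on $\Omega$ and $c_{l,i},\kappa_{l,i}$ measurable on $D_{f,l}$, all bounded above and below by positive constants, and let $Q_i\in\mathbb R$. For $\omega\subseteq\Omega$ put $$a_i^{\omega}(u,v)=\int_{\omega}\kappa_i\nabla u\cdot\nabla v\,dx+\sum_l\int_{D_{f,l}\cap\omega}\kappa_{l,i}\nabla_fu\cdot\nabla_fv\,dx,\qquad c_i(u,v)=\int_{\Omega}c_i\,uv\,dx+\sum_l\int_{D_{f,l}}c_{l,i}\,uv\,dx,$$ $a_i=a_i^\Omega$, and, for $N$-tuples, $\|u\|_c^2=\sum_ic_i(u_i,u_i)$, $\|u\|_a^2=\sum_ia_i(u_i,u_i)$, $q(u,v)=\sum_j\sum_{i\ne j}Q_i\int_\Omega(u_i-u_j)v_j\,dx$. For $\omega\subseteq\Omega$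 and a set $Z$ let $H^1_Z(\omega)$ be the closure, in the norm of $L^2$ of the values and of the first derivatives in $\omega$ and along the fractures in $\omega$, of the Lipschitz functions on $\overline\Omega$ that vanish on $Z$. Let $V=H^1_\Gamma(\Omega)$ and $H^1_0(\Omega)=H^1_{\partial\Omega}(\Omega)$ (so $\Gamma=\partial\Omega$ is the homogeneous Dirichlet problem, and for $\Gamma=\emptyset$ no boundary value is imposed on $u$). **Reference solution.** Let $T>0$, let $f(t)\in L^2(\Omega)^N$, and let $u\in H^1(0,T;V^N)$ (that is, $u$ and $\partial u/\partial t$ are in $L^2$ in time with values in the space of square-integrable values and first derivatives) satisfy, for a.e. $t\in(0,T)$, $$\sum_ic_i\Big(\frac{\partial u_i}{\partial t},v_i\Big)=-\sum_ia_i(u_i,v_i)+q(u,v)+(f,v)\qquad\text{for all }v\in H^1_0(\Omega)^N.$$ Assume that for some constant $D$, $-q(v,v)\le D\|v\|_a^2$ for all $v\in H_0^1(\Omega)^N$. **Un-coupled GMsFEM.** Let $\omega_1,\dots,\omega_m\subseteq\Omega$ be open (coarse regions), at most $M$ of them meeting at any point, and $\chi_1,\dots,\chi_m\ge0$ Lipschitz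 with $\sum_j\chi_j=1$ on $\Omega$ and $\chi_j=0$ on $\Omega\setminus\omega_j$. Let $V(\omega_j)=H^1_\Gamma(\omega_j)$ and $V_0(\omega_j)=H^1_{\Gamma\cup(\Omega\setminus\omega_j)}(\omega_j)$. Given, for each $j$, a (finite or infinite) family of boundary data $\delta_k^{(j)}\in V(\omega_j)$, the snapshot functions of the continuum $i$ in $\omega_j$ are the $\psi\in V(\omega_j)$ with $\psi-\delta^{(j)}_k\in V_0(\omega_j)$ and $a_i^{\omega_j}(\psi,v)=0$ for all $v\in V_0(\omega_j)$; their closed span is $V^{(i)}_{\rm snap}(\omega_j)$. Let $$s_i^{(j)}(u,v)=\int_{\omega_j}\kappa_i|\nabla\chi_j|^2uv\,dx+\sum_l\int_{D_{f,l}\cap\omega_j}\kappa_{l,i}|\nabla_f\chi_j|^2uv\,dx,$$ and let $(\phi^{(j)}_{k,i},\lambda^{(j)}_{k,i})_{k\ge1}$ be a complete $s_i^{(j)}$-orthonormal system of eigenpairs in $V^{(i)}_{\rm snap}(\omega_j)$, with $a_i^{\omega_j}(\phi^{(j)}_{k,i},v)=\lambda^{(j)}_{k,i}s^{(j)}_i(\phi^{(j)}_{k,i},v)$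 for all $v\in V^{(i)}_{\rm snap}(\omega_j)$, and eigenvalues in ascending order. Let $L_j$ (which may also depend on $i$) be less than the number of eigenpairs, let $\Lambda_1=\min_{j,i}\lambda^{(j)}_{L_j+1,i}$ be positive, and let $V_H=\prod_iV_H^{(i)}$ with $V_H^{(i)}=\operatorname{span}\{\chi_j\phi^{(j)}_{k,i}:1\le j\le m,\ k\le L_j\}$. For each $t\in[0,T]$ let $u^{(j)}_{{\rm snap},i}(t)\in V^{(i)}_{\rm snap}(\omega_j)$ agree with $u_i(t)$ on $\partial\omega_j$, i.e. $u^{(j)}_{{\rm snap},i}(t)-u_i(t)|_{\omega_j}\in V_0(\omega_j)$, and let $u^{(j)}_{{\rm snap},i}(t)=\sum_kc^{(j)}_{k,i}(t)\phi^{(j)}_{k,i}$ be its expansion. Put $$u_{{\rm snap},i}=\sum_j\chi_ju^{(j)}_{{\rm snap},i}=\sum_j\sum_kc^{(j)}_{k,i}\chi_j\phi^{(j)}_{k,i},\qquad w_i=\sum_j\sum_{k\le L_j}c^{(j)}_{k,i}\chi_j\phi^{(j)}_{k,i}.$$ **Theorem.** Suppose that $E$ is a finite constant with $c_i\chi_j^2\le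 E\,\kappa_i|\nabla\chi_j|^2$ a.e. in $\omega_j$ and $c_{l,i}\chi_j^2\le E\,\kappa_{l,i}|\nabla_f\chi_j|^2$ a.e. on $D_{f,l}\cap\omega_j$ for all $i,j,l$. Then $w(t)\in V_H$ for all $t\in[0,T]$, $w-u_{\rm snap}$ has a time derivative in $L^2$ in time (in the same sense as for $u$), and $$\int_0^T\Big\|\frac{\partial(w-u_{\rm snap})}{\partial t}\Big\|_c^2dt+\int_0^T\|w-u_{\rm snap}\|_a^2dt+\|w(0)-u_{\rm snap}(0)\|_c^2\le\frac C{\Lambda_1}\left(\int_0^T\Big\|\frac{\partial u}{\partial t}\Big\|_a^2dt+\int_0^T\|u\|_a^2dt+\|u(0)\|_a^2\right),$$ where $C$ depends only on $M$ and $E$. -/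

import Mathlib

open MeasureTheory Set

noncomputable section

/-- The Euclidean plane containing the two-dimensional matrix and the one-dimensional fractures. -/
abbrev Plane : Type := EuclideanSpace ℝ (Fin 2)

/-- The class of `f` in `L²(μ)`.  It is only applied to square-integrable functions
(for others the value is `0`). -/
def toL2 {α F : Type} [MeasurableSpace α] [NormedAddCommGroup F] (μ : Measure α)
    (f : α → F) : Lp F 2 μ := by
  classical
  exact if h : MemLp f 2 μ then h.toLp f else 0

/-- The data of an `N`-continuum problem on a bounded open set `Ω` of the plane with finitely many
fractures, each of them a `C¹` arc parametrized by arc length over `[0, len l]`. -/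
structure MultiContinuum where
  /-- number of continua -/
  N : ℕ
  /-- number of fractures -/
  F : ℕ
  /-- the domain -/
  Ω : Set Plane
  isOpen_Ω : IsOpen Ω
  isBounded_Ω : Bornology.IsBounded Ω
  nonempty_Ω : Ω.Nonempty
  /-- the part of the boundary on which functions vanish (all of it for the homogeneous
  Dirichlet problem, nothing if no boundary value is prescribed) -/
  Γ : Set Plane
  Γ_subset : Γ ⊆ frontier Ω
  /-- lengths of the fractures -/
  len : Fin F → ℝ
  len_pos : ∀ l, 0 < len l
  /-- arc-length parametrizations of the fractures -/
  path : Fin F → ℝ → Plane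
  path_contDiff : ∀ l, ContDiff ℝ 1 (path l)
  path_unit : ∀ l, ∀ s ∈ Icc 0 (len l), ‖deriv (path l) s‖ = 1
  path_inj : ∀ l, InjOn (path l) (Ico 0 (len l))
  path_mem : ∀ l, ∀ s ∈ Ioo 0 (len l), path l s ∈ Ω
  /-- `c_i` in the matrix -/
  c : Fin N → Plane → ℝ
  /-- `κ_i` in the matrix -/
  κ : Fin N → Plane → ℝ
  /-- `c_{l,i}` on the `l`-th fracture, as a function of arc length -/
  cF : Fin F → Fin N → ℝ → ℝ
  /-- `κ_{l,i}` on the `l`-th fracture, as a function of arc length -/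
  κF : Fin F → Fin N → ℝ → ℝ
  measurable_c : ∀ i, Measurable (c i)
  measurable_κ : ∀ i, Measurable (κ i)
  measurable_cF : ∀ l i, Measurable (cF l i)
  measurable_κF : ∀ l i, Measurable (κF l i)
  /-- all coefficients lie between two positive constants (of arbitrary ratio) -/
  lo : ℝ
  hi : ℝ
  lo_pos : 0 < lo
  c_mem : ∀ i, ∀ x ∈ Ω, c i x ∈ Icc lo hi
  κ_mem : ∀ i, ∀ x ∈ Ω, κ i x ∈ Icc lo hi
  cF_mem : ∀ l i, ∀ s ∈ Ioo 0 (len l), cF l i s ∈ Icc lo hi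
  κF_mem : ∀ l i, ∀ s ∈ Ioo 0 (len l), κF l i s ∈ Icc lo hi
  /-- transfer coefficients of the exchange term -/
  Q : Fin N → ℝ

namespace MultiContinuum

variable (P : MultiContinuum)

/-- Lebesgue measure on the matrix (the fractures are a null set of the plane). -/
abbrev μm : Measure Plane := volume.restrict P.Ω

/-- Arc length on the `l`-th fracture. -/
abbrev μf (l : Fin P.F) : Measure ℝ := volume.restrict (Ioo 0 (P.len l))

/-- The ambient Banach space: a value and a gradient in the matrix, and a value and a derivative
along each fracture, all square-integrable. -/
abbrev X : Type :=
  Lp ℝ 2 P.μm × Lp Plane 2 P.μm × ((l : Fin P.F) → Lp ℝ 2 (P.μf l)) ×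
    ((l : Fin P.F) → Lp ℝ 2 (P.μf l))

variable {P}

/-- value in the matrix -/
abbrev val (x : P.X) : Plane → ℝ := x.1
/-- gradient in the matrix -/
abbrev grad (x : P.X) : Plane → Plane := x.2.1
/-- value on the `l`-th fracture -/
abbrev fval (x : P.X) (l : Fin P.F) : ℝ → ℝ := x.2.2.1 l
/-- derivative along the `l`-th fracture -/
abbrev fder (x : P.X) (l : Fin P.F) : ℝ → ℝ := x.2.2.2 l

variable (P)

/-- The part of the parameter interval of the `l`-th fracture that lies in `ω`. -/
def fracIn (l : Fin P.F) (ω : Set Plane) : Set ℝ := Ioo 0 (P.len l) ∩ P.path l ⁻¹' ω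

/-- The element of the ambient space given by a function `φ` and its derivatives in the region
`ω`, extended by zero to the rest of `Ω`. -/
def embed (ω : Set Plane) (φ : Plane → ℝ) : P.X :=
  (toL2 _ (ω.indicator φ),
   toL2 _ (ω.indicator (gradient φ)),
   fun l => toL2 _ ((P.path l ⁻¹' ω).indicator (φ ∘ P.path l)),
   fun l => toL2 _ ((P.path l ⁻¹' ω).indicator (deriv (φ ∘ P.path l))))

/-- The space of `H¹` functions on the region `ω ⊆ Ω` (which are `H¹` along the fractures in `ω`
as well) that vanish on the set `Z`: the closure, in the norm of the values and of the first
derivatives in the matrix and along the fractures, of the Lipschitz functions that vanish on `Z`. -/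
def H1 (ω Z : Set Plane) : Submodule ℝ P.X :=
  (Submodule.span ℝ {x : P.X | ∃ (φ : Plane → ℝ) (K : NNReal),
    LipschitzOnWith K φ (closure P.Ω) ∧ (∀ z ∈ Z, φ z = 0) ∧ x = P.embed ω φ}).topologicalClosure

/-- The space `V` of the solution: `H¹(Ω)` functions that vanish on `Γ`. -/
abbrev V : Submodule ℝ P.X := P.H1 P.Ω P.Γ

/-- `H¹₀(Ω)`. -/
abbrev H10 : Submodule ℝ P.X := P.H1 P.Ω (frontier P.Ω)

/-- Restriction to the region `ω` (followed by extension by zero). -/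
def restr (ω : Set Plane) (x : P.X) : P.X :=
  (toL2 _ (ω.indicator (val x)),
   toL2 _ (ω.indicator (grad x)),
   fun l => toL2 _ ((P.path l ⁻¹' ω).indicator (fval x l)),
   fun l => toL2 _ ((P.path l ⁻¹' ω).indicator (fder x l)))

/-- Multiplication by a Lipschitz function `χ`, with the product rule for the derivatives. -/
def mul (χ : Plane → ℝ) (x : P.X) : P.X :=
  (toL2 _ (fun z => χ z * val x z),
   toL2 _ (fun z => χ z • grad x z + val x z • gradient χ z),
   fun l => toL2 _ (fun s => χ (P.path l s) * fval x l s),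
   fun l => toL2 _ (fun s => χ (P.path l s) * fder x l s + fval x l s * deriv (χ ∘ P.path l) s))

variable {P}

/-- `c_i(x, y)`. -/
def cForm (i : Fin P.N) (x y : P.X) : ℝ :=
  (∫ z in P.Ω, P.c i z * val x z * val y z) +
    ∑ l, ∫ s in Ioo 0 (P.len l), P.cF l i s * fval x l s * fval y l s

/-- The contribution of the region `ω ⊆ Ω` to `a_i(x, y)`. -/
def aLoc (ω : Set Plane) (i : Fin P.N) (x y : P.X) : ℝ :=
  (∫ z in ω, P.κ i z * inner ℝ (grad x z) (grad y z)) +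
    ∑ l, ∫ s in P.fracIn l ω, P.κF l i s * fder x l s * fder y l s

/-- `a_i(x, y)`. -/
def aForm (i : Fin P.N) (x y : P.X) : ℝ := aLoc P.Ω i x y

/-- The exchange form `q(u, v)`. -/
def qForm (u v : Fin P.N → P.X) : ℝ :=
  ∑ j, ∑ i ∈ Finset.univ.filter (fun i => i ≠ j),
    P.Q i * ∫ z in P.Ω, (val (u i) z - val (u j) z) * val (v j) z

/-- `(f, v)`. -/
def source (f : Fin P.N → Lp ℝ 2 P.μm) (v : Fin P.N → P.X) : ℝ :=
  ∑ i, ∫ z in P.Ω, f i z * val (v i) z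

/-- `‖u‖_c²`. -/
def cNormSq (u : Fin P.N → P.X) : ℝ := ∑ i, cForm i (u i) (u i)

/-- `‖u‖_a²`. -/
def aNormSq (u : Fin P.N → P.X) : ℝ := ∑ i, aForm i (u i) (u i)

/-- `u` belongs to `H¹(0, T; X^N)`, is represented by its continuous representative on `[0, T]`,
and has the time derivative `d ∈ L²(0, T; X^N)`. -/
def IsTimeDeriv (T : ℝ) (u d : ℝ → Fin P.N → P.X) : Prop :=
  MemLp d 2 (volume.restrict (Ioc 0 T)) ∧
    ∀ t ∈ Icc 0 T, u t = u 0 + ∫ s in (0 : ℝ)..t, d s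

/-- `u` is a solution on `(0, T)` of the multi-continuum problem with source `f`, with values
in `V` and with time derivative `du`. -/
def IsReference (T : ℝ) (f : ℝ → Fin P.N → Lp ℝ 2 P.μm) (u du : ℝ → Fin P.N → P.X) : Prop :=
  (∀ t ∈ Icc 0 T, ∀ i, u t i ∈ P.V) ∧ IsTimeDeriv T u du ∧
    ∀ᵐ t ∂volume.restrict (Ioo 0 T), ∀ v : Fin P.N → P.X, (∀ i, v i ∈ P.H10) →
      ∑ i, cForm i (du t i) (v i) =
        -(∑ i, aForm i (u t i) (v i)) + qForm (u t) v + source (f t) v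

/-- The coarse regions `ω_j` and the partition of unity `χ_j`, together with the data
`δ_k` that are prescribed on `∂ω_j` for the snapshot functions (as functions on `ω_j`, of which
only the boundary values matter). -/
structure Coarse (P : MultiContinuum) where
  /-- number of coarse regions -/
  m : ℕ
  ω : Fin m → Set Plane
  isOpen_ω : ∀ j, IsOpen (ω j)
  ω_subset : ∀ j, ω j ⊆ P.Ω
  χ : Fin m → Plane → ℝ
  χ_lipschitz : ∀ j, ∃ K : NNReal, LipschitzOnWith K (χ j) (closure P.Ω)
  χ_nonneg : ∀ j, ∀ x ∈ P.Ω, 0 ≤ χ j x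
  χ_support : ∀ j, ∀ x ∈ P.Ω \ ω j, χ j x = 0
  χ_sum : ∀ x ∈ P.Ω, ∑ j, χ j x = 1
  /-- index sets of the boundary data -/
  K : Fin m → Type
  δ : (j : Fin m) → K j → P.X
  δ_mem : ∀ j k, δ j k ∈ P.H1 (ω j) P.Γ

namespace Coarse

variable (G : Coarse P)

/-- Fine-scale functions on `ω_j`. -/
abbrev Vloc (j : Fin G.m) : Submodule ℝ P.X := P.H1 (G.ω j) P.Γ

/-- Fine-scale functions on `ω_j` with zero trace on the boundary of `ω_j` (inside `Ω`, and
on `Γ`). -/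
abbrev V0 (j : Fin G.m) : Submodule ℝ P.X := P.H1 (G.ω j) (P.Γ ∪ (P.Ω \ G.ω j))

/-- `ψ` is the `k`-th snapshot function of the continuum `i` in `ω_j`. -/
def IsSnapshot (j : Fin G.m) (i : Fin P.N) (k : G.K j) (ψ : P.X) : Prop :=
  ψ ∈ G.Vloc j ∧ (∀ v ∈ G.V0 j, aLoc (G.ω j) i ψ v = 0) ∧ ψ - G.δ j k ∈ G.V0 j

/-- The local snapshot space (the closure is superfluous if there are finitely many data). -/
def Vsnap (j : Fin G.m) (i : Fin P.N) : Submodule ℝ P.X :=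
  (Submodule.span ℝ {ψ : P.X | ∃ k, G.IsSnapshot j i k ψ}).topologicalClosure

/-- `s_i^{(j)}(x, y)`. -/
def sForm (j : Fin G.m) (i : Fin P.N) (x y : P.X) : ℝ :=
  (∫ z in G.ω j, P.κ i z * ‖gradient (G.χ j) z‖ ^ 2 * val x z * val y z) +
    ∑ l, ∫ s in P.fracIn l (G.ω j),
      P.κF l i s * (deriv (G.χ j ∘ P.path l) s) ^ 2 * fval x l s * fval y l s

/-- At most `M` coarse regions meet at any point. -/
def OverlapLE (M : ℕ) : Prop := ∀ x, {j | x ∈ G.ω j}.ncard ≤ M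

/-- `E` is an upper bound for all the ratios `c_i χ_j² / (κ_i |∇χ_j|²)` and
`c_{l,i} χ_j² / (κ_{l,i} |∇_f χ_j|²)`. -/
def RatioLE (E : ℝ) : Prop :=
  ∀ j i,
    (∀ᵐ z ∂volume.restrict (G.ω j),
      P.c i z * (G.χ j z) ^ 2 ≤ E * (P.κ i z * ‖gradient (G.χ j) z‖ ^ 2)) ∧
    ∀ l, ∀ᵐ s ∂volume.restrict (P.fracIn l (G.ω j)),
      P.cF l i s * (G.χ j (P.path l s)) ^ 2 ≤
        E * (P.κF l i s * (deriv (G.χ j ∘ P.path l) s) ^ 2)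

/-- The complete system of the eigenpairs of the local spectral problem of the continuum `i` in
`ω_j`, in ascending order and numbered from `0`; `n` is their number, finite or infinite, and
`φ k = 0` for `k ≥ n`. -/
structure EigenSystem (j : Fin G.m) (i : Fin P.N) where
  n : ℕ∞
  φ : ℕ → P.X
  lam : ℕ → ℝ
  mem : ∀ k, φ k ∈ G.Vsnap j i
  eq_zero : ∀ k : ℕ, n ≤ k → φ k = 0
  eigen : ∀ k : ℕ, (k : ℕ∞) < n → ∀ v ∈ G.Vsnap j i,
    aLoc (G.ω j) i (φ k) v = lam k * G.sForm j i (φ k) v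
  orthonormal : ∀ k l : ℕ, (k : ℕ∞) < n → (l : ℕ∞) < n →
    G.sForm j i (φ k) (φ l) = if k = l then 1 else 0
  ascending : ∀ k l : ℕ, k ≤ l → (l : ℕ∞) < n → lam k ≤ lam l
  complete : G.Vsnap j i ≤ (Submodule.span ℝ (range φ)).topologicalClosure

variable {G}

/-- The minimum over the coarse regions and continua of the `(L_j + 1)`-th eigenvalue
(which has the number `L_j` here). -/
def Lambda (S : ∀ j i, G.EigenSystem j i) (L : Fin G.m → Fin P.N → ℕ) : ℝ :=
  ⨅ p : Fin G.m × Fin P.N, (S p.1 p.2).lam (L p.1 p.2)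

/-- The un-coupled offline space of the continuum `i`. -/
def VH (S : ∀ j i, G.EigenSystem j i) (L : Fin G.m → Fin P.N → ℕ) (i : Fin P.N) :
    Submodule ℝ P.X :=
  Submodule.span ℝ {x | ∃ j, ∃ k < L j i, x = P.mul (G.χ j) ((S j i).φ k)}

/-- `r j i` are the local snapshot projections of `u`: elements of the local snapshot spaces that
agree with `u` on `∂ω_j`. -/
def IsLocalSnap (u : Fin P.N → P.X) (r : Fin G.m → Fin P.N → P.X) : Prop :=
  ∀ j i, r j i ∈ G.Vsnap j i ∧ r j i - P.restr (G.ω j) (u i) ∈ G.V0 j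

/-- The snapshot projection `∑_j χ_j r_j`. -/
def usnap (r : Fin G.m → Fin P.N → P.X) (i : Fin P.N) : P.X :=
  ∑ j, P.mul (G.χ j) (r j i)

/-- The offline projection `∑_j ∑_{k ≤ L_j} b_k χ_j φ_k`. -/
def offline (S : ∀ j i, G.EigenSystem j i) (L : Fin G.m → Fin P.N → ℕ)
    (b : Fin G.m → Fin P.N → ℕ → ℝ) (i : Fin P.N) : P.X :=
  ∑ j, ∑ k ∈ Finset.range (L j i), b j i k • P.mul (G.χ j) ((S j i).φ k)

end Coarse

end MultiContinuum

end

/-! Let `e_j` be the tail of the expansion of the local snapshot projection `r_j`, so that the error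
is `-∑ χ_j e_j`. Since `e_j` is harmonic and `χ_j² e_j` has zero trace, the product rule gives the
exact identity `a(χ_j e_j, χ_j e_j) = s_j(e_j, e_j)` (`aForm_mul_self`); the ratio hypothesis gives
`c(χ_j e_j, χ_j e_j) ≤ E s_j(e_j, e_j)` (`cForm_mul_self_le`). Orthogonality of the eigenfunctions
for both forms yields `Λ s_j(e_j, e_j) ≤ a_j(r_j, r_j)` (`tail_bound`), and the Dirichlet principle
yields `a_j(r_j, r_j) ≤ a_j(u, u)` (`aLoc_le_of_sub_mem`). Finite overlap, used once for the sum of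
the `χ_j e_j` and once for the sum of the local energies, costs `M²`. This bounds the error at each
fixed time (`errorPair_bound`).

For the time derivative, nothing is assumed about how `r` and `b` depend on time. But the pairs
(function, error) form a linear subspace, and the fixed-time bound makes it the graph of a bounded
operator. Its closure is the graph of a bounded operator on a closed subspace; `du` lies in that
subspace almost everywhere, because the increments of `u` do, and the derivative of the error is the
image of `du` (`exists_deriv_of_graph`). The pair of derivatives lies in the closed graph, so it
obeys the same bound, and integration in time finishes the proof. -/

/-! ### Continuous bilinear forms and orthogonal expansions. -/

section BilinearForms

variable {X Y : Type*} [NormedAddCommGroup X] [NormedSpace ℝ X] [NormedAddCommGroup Y]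
  [NormedSpace ℝ Y]

/-- `b` is a continuous bilinear form. -/
def IsContBilin (b : X → X → ℝ) : Prop :=
  ∃ B : X →L[ℝ] X →L[ℝ] ℝ, ∀ x y, b x y = B x y

theorem IsContBilin.add {b b' : X → X → ℝ} (h : IsContBilin b) (h' : IsContBilin b') :
    IsContBilin (fun x y => b x y + b' x y) := by
  obtain ⟨B, hB⟩ := h
  obtain ⟨B', hB'⟩ := h'
  exact ⟨B + B', fun x y => by simp [hB, hB']⟩

theorem IsContBilin.sum {ι : Type*} (s : Finset ι) {b : ι → X → X → ℝ}
    (h : ∀ i, IsContBilin (b i)) : IsContBilin (fun x y => ∑ i ∈ s, b i x y) := by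
  choose B hB using h
  exact ⟨∑ i ∈ s, B i, fun x y => by simp [hB]⟩

theorem IsContBilin.comp {b : Y → Y → ℝ} (h : IsContBilin b) (T : X →L[ℝ] Y) :
    IsContBilin (fun x y => b (T x) (T y)) := by
  obtain ⟨B, hB⟩ := h
  exact ⟨B.bilinearComp T T, fun x y => by simp [hB]⟩

/-- Pairing the expansion with `φ k` leaves a single term; pairing it once more with `r` gives the
sum. Only continuity is used, so `A` may be degenerate, as `s_j` is wherever `χ_j` is constant. -/
theorem hasSum_of_orthogonal (A : X →L[ℝ] X →L[ℝ] ℝ) {φ : ℕ → X} {b : ℕ → ℝ} {r : X}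
    (hr : HasSum (fun k => b k • φ k) r) (hA : ∀ k l, k ≠ l → A (φ k) (φ l) = 0) :
    HasSum (fun k => b k ^ 2 * A (φ k) (φ k)) (A r r) := by
  have h1 : ∀ k, A (φ k) r = b k * A (φ k) (φ k) := by
    intro k
    have h2 : HasSum (fun l => b l * A (φ k) (φ l)) (A (φ k) r) := by
      simpa using (A (φ k)).hasSum hr
    refine h2.unique ?_
    refine hasSum_single k fun l hl => ?_
    rw [hA k l hl.symm, mul_zero]
  have h3 : HasSum (fun k => b k * A (φ k) r) (A r r) := by
    simpa using (A.flip r).hasSum hr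
  convert h3 using 2 with k
  rw [h1]
  ring

/-- The tail is kept as a series over the same `φ` with its first `L` coefficients set to zero, so
that it can be compared term by term with the full expansion. -/
theorem hasSum_tail {φ : ℕ → X} {b : ℕ → ℝ} {r : X}
    (hr : HasSum (fun k => b k • φ k) r) (L : ℕ) :
    HasSum (fun k => (if k < L then 0 else b k) • φ k)
      (r - ∑ k ∈ Finset.range L, b k • φ k) := by
  have h : HasSum (fun k => (if k < L then b k else 0) • φ k)
      (∑ k ∈ Finset.range L, b k • φ k) := by
    have := hasSum_sum_of_ne_finset_zero (f := fun k => (if k < L then b k else 0) • φ k)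
      (s := Finset.range L) (L := .unconditional ℕ) (fun k hk => by simp at hk; simp [not_lt.2 hk])
    convert this using 1
    exact Finset.sum_congr rfl fun k hk => by simp [Finset.mem_range.1 hk]
  convert hr.sub h using 2 with k
  split_ifs <;> simp

/-- The tail of an eigenfunction expansion is controlled by the energy of the expansion. -/
theorem tail_bound (A S : X →L[ℝ] X →L[ℝ] ℝ) {φ : ℕ → X} {b : ℕ → ℝ} {r : X}
    (hr : HasSum (fun k => b k • φ k) r) (hA : ∀ k l, k ≠ l → A (φ k) (φ l) = 0)
    (hS : ∀ k l, k ≠ l → S (φ k) (φ l) = 0) (hA0 : ∀ k, 0 ≤ A (φ k) (φ k)) (L : ℕ) {Λ : ℝ}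
    (hΛ : ∀ k, L ≤ k → Λ * S (φ k) (φ k) ≤ A (φ k) (φ k)) {e : X}
    (he : e = r - ∑ k ∈ Finset.range L, b k • φ k) : Λ * S e e ≤ A r r := by
  have ht := hasSum_tail hr L
  rw [← he] at ht
  -- Both sides are diagonal sums: for `k < L` the left term is zero, and for `k ≥ L` the spectral
  -- gap `hΛ` applies.
  refine hasSum_le ?_ ((hasSum_of_orthogonal S ht hS).mul_left Λ) (hasSum_of_orthogonal A hr hA)
  intro k
  split_ifs with h
  · simpa using mul_nonneg (sq_nonneg (b k)) (hA0 k)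
  · have := mul_le_mul_of_nonneg_left (hΛ k (not_lt.1 h)) (sq_nonneg (b k))
    linarith

end BilinearForms

/-! ### Essentially bounded multipliers acting on `L²`. -/

section Pointwise

variable {α F F' : Type*} [MeasurableSpace α] {μ : Measure α} [NormedAddCommGroup F]
  [NormedAddCommGroup F']

/-- Essentially bounded, with measurability. -/
def EssBdd (μ : Measure α) (a : α → F) : Prop :=
  AEStronglyMeasurable a μ ∧ ∃ C, ∀ᵐ z ∂μ, ‖a z‖ ≤ C

theorem EssBdd.mono {a : α → F} (h : EssBdd μ a) {ν : Measure α} (hν : ν ≤ μ) : EssBdd ν a :=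
  ⟨h.1.mono_measure hν, h.2.imp fun _ hC => ae_mono hν hC⟩

theorem EssBdd.indicator {a : α → F} (h : EssBdd μ a) {s : Set α} (hs : MeasurableSet s) :
    EssBdd μ (s.indicator a) := by
  refine ⟨h.1.indicator hs, h.2.imp fun C hC => hC.mono fun z hz => ?_⟩
  exact (norm_indicator_le_norm_self a z).trans hz

theorem EssBdd.mul {a b : α → ℝ} (h : EssBdd μ a) (h' : EssBdd μ b) :
    EssBdd μ (fun z => a z * b z) := by
  obtain ⟨C, hC⟩ := h.2
  obtain ⟨C', hC'⟩ := h'.2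
  refine ⟨h.1.mul h'.1, C * C', ?_⟩
  filter_upwards [hC, hC'] with z hz hz'
  rw [norm_mul]
  exact mul_le_mul hz hz' (norm_nonneg _) ((norm_nonneg _).trans hz)

theorem EssBdd.norm_sq {a : α → F} (h : EssBdd μ a) : EssBdd μ (fun z => ‖a z‖ ^ 2) := by
  obtain ⟨C, hC⟩ := h.2
  refine ⟨h.1.norm.pow 2, C ^ 2, ?_⟩
  filter_upwards [hC] with z hz
  rw [norm_pow, norm_norm]
  gcongr

theorem EssBdd.memLp [IsFiniteMeasure μ] {a : α → F} (h : EssBdd μ a) (p : ENNReal) :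
    MemLp a p μ :=
  let ⟨_, hC⟩ := h.2
  MemLp.of_bound h.1 _ hC

variable [NormedSpace ℝ F] [NormedSpace ℝ F']

theorem EssBdd.comp_clm {a : α → F} (h : EssBdd μ a) (T : F →L[ℝ] F') :
    EssBdd μ (fun z => T (a z)) := by
  obtain ⟨C, hC⟩ := h.2
  refine ⟨T.continuous.comp_aestronglyMeasurable h.1, ‖T‖ * C, hC.mono fun z hz => ?_⟩
  exact (T.le_opNorm _).trans (mul_le_mul_of_nonneg_left hz (norm_nonneg _))

theorem EssBdd.memLp_apply {a : α → F →L[ℝ] F'} (h : EssBdd μ a) {x : α → F}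
    (hx : MemLp x 2 μ) : MemLp (fun z => a z (x z)) 2 μ := by
  obtain ⟨C, hC⟩ := h.2
  refine MemLp.of_le_mul (c := C) hx ?_ ?_
  · exact isBoundedBilinearMap_apply.continuous.comp_aestronglyMeasurable
      (h.1.prodMk hx.1)
  · filter_upwards [hC] with z hz
    exact ((a z).le_opNorm _).trans (mul_le_mul_of_nonneg_right hz (norm_nonneg _))

theorem EssBdd.memLp_smul {a : α → ℝ} (h : EssBdd μ a) {x : α → F} (hx : MemLp x 2 μ) :
    MemLp (fun z => a z • x z) 2 μ := by
  simpa using (h.comp_clm (ContinuousLinearMap.lsmul ℝ ℝ (E := F))).memLp_apply hx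

/-- Pointwise application of a bounded field of operators, as an operator on `L²`. -/
theorem EssBdd.exists_clm {a : α → F →L[ℝ] F'} (h : EssBdd μ a) :
    ∃ T : Lp F 2 μ →L[ℝ] Lp F' 2 μ, ∀ x, T x =ᵐ[μ] fun z => a z (x z) := by
  obtain ⟨C, hC⟩ := h.2
  have hm : ∀ x : Lp F 2 μ, MemLp (fun z => a z (x z)) 2 μ := fun x => h.memLp_apply (Lp.memLp x)
  let T0 : Lp F 2 μ →ₗ[ℝ] Lp F' 2 μ :=
    { toFun := fun x => (hm x).toLp _
      map_add' := fun x y => by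
        refine Lp.ext ?_
        filter_upwards [(hm (x + y)).coeFn_toLp, (hm x).coeFn_toLp, (hm y).coeFn_toLp,
          Lp.coeFn_add x y, Lp.coeFn_add ((hm x).toLp _) ((hm y).toLp _)] with z h1 h2 h3 h4 h5
        rw [h1, h5, Pi.add_apply, h2, h3, h4, Pi.add_apply, map_add]
      map_smul' := fun c x => by
        refine Lp.ext ?_
        filter_upwards [(hm (c • x)).coeFn_toLp, (hm x).coeFn_toLp,
          Lp.coeFn_smul c x, Lp.coeFn_smul c ((hm x).toLp _)] with z h1 h2 h4 h5
        rw [RingHom.id_apply, h1, h5, Pi.smul_apply, h2, h4, Pi.smul_apply, map_smul] }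
  refine ⟨T0.mkContinuous C fun x => ?_, fun x => (hm x).coeFn_toLp⟩
  refine Lp.norm_le_mul_norm_of_ae_le_mul ?_
  filter_upwards [(hm x).coeFn_toLp, hC] with z h1 h2
  change ‖((hm x).toLp _ : Lp F' 2 μ) z‖ ≤ _
  rw [h1]
  exact ((a z).le_opNorm _).trans (mul_le_mul_of_nonneg_right h2 (norm_nonneg _))

theorem EssBdd.exists_clm_smul {a : α → ℝ} (h : EssBdd μ a) :
    ∃ T : Lp F 2 μ →L[ℝ] Lp F 2 μ, ∀ x, T x =ᵐ[μ] fun z => a z • x z := by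
  simpa using (h.comp_clm (ContinuousLinearMap.lsmul ℝ ℝ (E := F))).exists_clm

end Pointwise

/-! ### Weighted `L²` forms, the product rule energy, finite overlap. -/

section Weighted

variable {α F : Type*} [MeasurableSpace α] {μ : Measure α} [NormedAddCommGroup F]
  [InnerProductSpace ℝ F]

theorem EssBdd.integrable_inner {w : α → ℝ} (h : EssBdd μ w) {x y : α → F} (hx : MemLp x 2 μ)
    (hy : MemLp y 2 μ) : Integrable (fun z => w z * inner ℝ (x z) (y z)) μ := by
  obtain ⟨C, hC⟩ := h.2
  refine Integrable.bdd_mul ?_ h.1 hC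
  refine (L2.integrable_inner (𝕜 := ℝ) (hx.toLp x) (hy.toLp y)).congr ?_
  filter_upwards [hx.coeFn_toLp, hy.coeFn_toLp] with z h1 h2
  rw [h1, h2]

theorem EssBdd.isContBilin_inner {w : α → ℝ} (h : EssBdd μ w) :
    IsContBilin (fun x y : Lp F 2 μ => ∫ z, w z * inner ℝ (x z) (y z) ∂μ) := by
  obtain ⟨T, hT⟩ := h.exists_clm_smul (F := F)
  refine ⟨(isBoundedBilinearMap_inner (𝕜 := ℝ) (E := Lp F 2 μ)).toContinuousLinearMap.comp T,
    fun x y => ?_⟩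
  change _ = inner ℝ (T x) y
  rw [L2.inner_def]
  refine integral_congr_ae ?_
  filter_upwards [hT x] with z hz
  rw [hz, real_inner_smul_left]

theorem EssBdd.isContBilin_mul {w : α → ℝ} (h : EssBdd μ w) :
    IsContBilin (fun x y : Lp ℝ 2 μ => ∫ z, w z * x z * y z ∂μ) := by
  convert h.isContBilin_inner (F := ℝ) using 5 with x y z
  simp [mul_assoc, mul_comm]

/-- The energy of `χ v` for the product rule gradient `χ g + v Dχ`. -/
theorem integral_product_energy {w χ v : α → ℝ} {Dχ g g₁ g₂ : α → F} {v₁ : α → ℝ}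
    (hw : EssBdd μ w) (hD : EssBdd μ Dχ) (hv : MemLp v 2 μ) (hg : MemLp g 2 μ)
    (hg₂ : MemLp g₂ 2 μ) (e1 : v₁ =ᵐ[μ] fun z => χ z * v z)
    (e2 : g₁ =ᵐ[μ] fun z => χ z • g z + v z • Dχ z)
    (e3 : g₂ =ᵐ[μ] fun z => χ z • g₁ z + v₁ z • Dχ z) :
    ∫ z, w z * inner ℝ (g₁ z) (g₁ z) ∂μ =
      ∫ z, w z * inner ℝ (g z) (g₂ z) ∂μ + ∫ z, w z * ‖Dχ z‖ ^ 2 * v z * v z ∂μ := by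
  have hi : Integrable (fun z => w z * ‖Dχ z‖ ^ 2 * v z * v z) μ := by
    have := (hw.mul hD.norm_sq).integrable_inner hv hv
    refine this.congr (.of_forall fun z => ?_)
    simp [mul_assoc, sq]
  rw [← integral_add (hw.integrable_inner hg hg₂) hi]
  refine integral_congr_ae ?_
  filter_upwards [e1, e2, e3] with z h1 h2 h3
  -- Here `g₁` and `g₂` are the gradients of `χ v` and `χ² v`. The two cross terms of `|χ g + v
  -- Dχ|²` are exactly those of `g · g₂`, so only `|Dχ|² v²` is left over.
  rw [h3, h2, h1]
  simp only [inner_add_left, inner_add_right, real_inner_smul_left, real_inner_smul_right,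
    ← real_inner_self_eq_norm_sq]
  rw [real_inner_comm (Dχ z) (g z)]
  ring

/-- At each point at most `M` summands are nonzero, so Cauchy–Schwarz bounds the square of the sum
by `M` times the sum of squares. -/
theorem integral_overlap_le {ι : Type*} [Fintype ι] {w : α → ℝ} (hw : EssBdd μ w)
    (hw0 : ∀ᵐ z ∂μ, 0 ≤ w z) {ω : ι → Set α} {M : ℕ} (hM : ∀ z, {j | z ∈ ω j}.ncard ≤ M)
    {g : ι → α → F} (hg : ∀ j, MemLp (g j) 2 μ) (h0 : ∀ j, ∀ᵐ z ∂μ, z ∉ ω j → g j z = 0)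
    {y : α → F} (hy : y =ᵐ[μ] fun z => ∑ j, g j z) :
    ∫ z, w z * inner ℝ (y z) (y z) ∂μ ≤ M * ∑ j, ∫ z, w z * inner ℝ (g j z) (g j z) ∂μ := by
  classical
  rw [← integral_finsetSum _ fun j _ => hw.integrable_inner (hg j) (hg j), ← integral_const_mul]
  have hym : MemLp y 2 μ := (memLp_finsetSum _ fun j _ => hg j).ae_eq hy.symm
  refine integral_mono_ae (hw.integrable_inner hym hym)
    ((integrable_finsetSum _ fun j _ => hw.integrable_inner (hg j) (hg j)).const_mul _) ?_
  filter_upwards [hy, hw0, ae_all_iff.2 h0] with z h1 h2 h3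
  rw [← Finset.mul_sum, mul_left_comm]
  refine mul_le_mul_of_nonneg_left ?_ h2
  simp only [real_inner_self_eq_norm_sq]
  set s : Finset ι := Finset.univ.filter fun j => z ∈ ω j
  have hs : (s.card : ℝ) ≤ M := by
    have := hM z
    rw [Set.ncard_eq_toFinset_card'] at this
    exact_mod_cast (by simpa [s] using this : s.card ≤ M)
  have e1 : y z = ∑ j ∈ s, g j z := by
    rw [h1]
    exact (Finset.sum_filter_of_ne fun j _ hj => by_contra fun h => hj (h3 j h)).symm
  calc ‖y z‖ ^ 2 ≤ (∑ j ∈ s, ‖g j z‖) ^ 2 := by rw [e1]; gcongr; exact norm_sum_le _ _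
    _ ≤ s.card * ∑ j ∈ s, ‖g j z‖ ^ 2 := sq_sum_le_card_mul_sum_sq
    _ ≤ M * ∑ j, ‖g j z‖ ^ 2 := by
      gcongr
      exact Finset.filter_subset _ _

/-- The indicator functions of the `ω j` add up to at most `M` at every point. -/
theorem sum_setIntegral_overlap_le {ι : Type*} [Fintype ι] {h : α → ℝ} (hi : Integrable h μ)
    (h0 : ∀ᵐ z ∂μ, 0 ≤ h z) {ω : ι → Set α} (hω : ∀ j, MeasurableSet (ω j)) {M : ℕ}
    (hM : ∀ z, {j | z ∈ ω j}.ncard ≤ M) :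
    ∑ j, ∫ z in ω j, h z ∂μ ≤ M * ∫ z, h z ∂μ := by
  classical
  simp only [← integral_indicator (hω _)]
  rw [← integral_finsetSum _ fun j _ => hi.indicator (hω j), ← integral_const_mul]
  refine integral_mono_ae (integrable_finsetSum _ fun j _ => hi.indicator (hω j))
    (hi.const_mul _) ?_
  filter_upwards [h0] with z h2
  have : ∑ j, (ω j).indicator h z = (Finset.univ.filter fun j => z ∈ ω j).card * h z := by
    simp [Set.indicator_apply, ← Finset.sum_filter]
  rw [this]
  refine mul_le_mul_of_nonneg_right ?_ h2
  have := hM z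
  rw [Set.ncard_eq_toFinset_card'] at this
  exact_mod_cast (by simpa using this : (Finset.univ.filter fun j => z ∈ ω j).card ≤ M)

end Weighted

/-! ### Time derivatives and operators given by their graphs. -/

section TimeDerivative

variable {A B : Type*} [NormedAddCommGroup A] [NormedSpace ℝ A] [CompleteSpace A]
  [NormedAddCommGroup B] [NormedSpace ℝ B] [CompleteSpace B]

/-- A function whose increments lie in a closed subspace has its derivative in that subspace. -/
theorem ae_mem_of_integral_mem {R : Submodule ℝ A} (hR : IsClosed (R : Set A)) {T : ℝ}
    {u du : ℝ → A} (hdu : IntervalIntegrable du volume 0 T)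
    (hu : ∀ t ∈ Icc 0 T, u t = u 0 + ∫ s in (0 : ℝ)..t, du s) (hm : ∀ t ∈ Icc 0 T, u t ∈ R) :
    ∀ᵐ t ∂volume.restrict (Ioc 0 T), du t ∈ R := by
  rw [ae_restrict_iff' measurableSet_Ioc]
  -- Without the endpoint, `t` is interior and all nearby difference quotients use times in `[0,
  -- T]`.
  have h₂ : ∀ᵐ x : ℝ, x ≠ T := by simp [ae_iff, measure_singleton]
  filter_upwards [hdu.ae_hasDerivAt_integral, h₂] with t ht hT htm
  have htm' : t ∈ Ioo 0 T := ⟨htm.1, lt_of_le_of_ne htm.2 hT⟩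
  have hT0 : 0 ≤ T := htm.1.le.trans htm.2
  have hmem : ∀ s ∈ Icc 0 T, (∫ s in (0 : ℝ)..s, du s) ∈ R := fun s hs => by
    have := R.sub_mem (hm s hs) (hm 0 (left_mem_Icc.2 hT0))
    rwa [hu s hs, add_sub_cancel_left] at this
  -- By Lebesgue differentiation `du t` is a limit of difference quotients of the primitive; these
  -- lie in `R`, which is closed.
  have hd := ht (by rw [uIcc_of_le hT0]; exact Ioo_subset_Icc_self htm') 0 left_mem_uIcc
  have hs := hasDerivAt_iff_tendsto_slope.1 hd
  refine hR.mem_of_tendsto hs ?_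
  have : ∀ᶠ s in nhdsWithin t {t}ᶜ, s ∈ Ioo 0 T :=
    nhdsWithin_le_nhds (Ioo_mem_nhds htm'.1 htm'.2)
  filter_upwards [this] with s hs
  rw [slope_def_module]
  exact R.smul_mem _ (R.sub_mem (hmem s (Ioo_subset_Icc_self hs))
    (hmem t (Ioo_subset_Icc_self htm')))

/-- The image of an `H¹` function under a bounded operator that is given by its graph. -/
theorem exists_deriv_of_graph {G : Submodule ℝ (A × B)} {K : ℝ}
    (hK : ∀ p ∈ G, ‖p.2‖ ≤ K * ‖p.1‖) {T : ℝ} (hT : 0 < T) {u du : ℝ → A} {y : ℝ → B}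
    (hdu : MemLp du 2 (volume.restrict (Ioc 0 T)))
    (hu : ∀ t ∈ Icc 0 T, u t = u 0 + ∫ s in (0 : ℝ)..t, du s)
    (hy : ∀ t ∈ Icc 0 T, (u t, y t) ∈ G) :
    ∃ d : ℝ → B, MemLp d 2 (volume.restrict (Ioc 0 T)) ∧
      (∀ t ∈ Icc 0 T, y t = y 0 + ∫ s in (0 : ℝ)..t, d s) ∧
      ∀ᵐ t ∂volume.restrict (Ioc 0 T), (du t, d t) ∈ closure (G : Set (A × B)) := by
  classical
  set H := G.topologicalClosure
  -- The bound is a closed condition, so it passes to the closure, which therefore remains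
  -- single-valued.
  have hH : ∀ p ∈ H, ‖p.2‖ ≤ K * ‖p.1‖ := by
    have hc : IsClosed {p : A × B | ‖p.2‖ ≤ K * ‖p.1‖} :=
      isClosed_le (by fun_prop) (by fun_prop)
    exact fun p hp => closure_minimal (s := (G : Set (A × B))) hK hc hp
  have : CompleteSpace H := G.isClosed_topologicalClosure.completeSpace_coe
  let g : H →L[ℝ] A := (ContinuousLinearMap.fst ℝ A B).comp H.subtypeL
  have hg : ∀ p : H, g p = p.1.1 := fun _ => rfl
  -- On `H` the first component controls the whole pair. Hence the first projection is injective
  -- with closed range `R`, and its inverse followed by the second projection is the bounded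
  -- operator `S`.
  have hanti : AntilipschitzWith (Real.toNNReal (max 1 K)) g := by
    refine AddMonoidHomClass.antilipschitz_of_bound g fun p => ?_
    have h0 : (0 : ℝ) ≤ max 1 K := le_max_of_le_left zero_le_one
    rw [Real.coe_toNNReal _ h0, hg]
    change ‖p.1‖ ≤ _
    rw [Prod.norm_def]
    refine max_le ?_ ((hH _ p.2).trans ?_)
    · exact le_mul_of_one_le_left (norm_nonneg _) (le_max_left _ _)
    · exact mul_le_mul_of_nonneg_right (le_max_right _ _) (norm_nonneg _)
  have hcl : IsClosed (range g) := hanti.isClosed_range g.uniformContinuous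
  let e := g.equivRange hanti.injective hcl
  have he : ∀ p : H, ((e p : LinearMap.range (g : H →ₗ[ℝ] A)) : A) = p.1.1 := fun _ => rfl
  let R : Submodule ℝ A := LinearMap.range (g : H →ₗ[ℝ] A)
  let S : R →L[ℝ] B := ((ContinuousLinearMap.snd ℝ A B).comp H.subtypeL).comp
    (e.symm : R →L[ℝ] H)
  have hSH : ∀ x : R, ((x : A), S x) ∈ H := fun x => by
    have h1 := he (e.symm x)
    rw [e.apply_symm_apply] at h1
    have h2 := (e.symm x).2
    rw [h1]
    exact h2
  have hS : ∀ a b, (h : (a, b) ∈ H) → ∃ h' : a ∈ R, S ⟨a, h'⟩ = b := fun a b h => by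
    refine ⟨⟨⟨(a, b), h⟩, rfl⟩, ?_⟩
    have : (⟨a, ⟨⟨(a, b), h⟩, rfl⟩⟩ : R) = e ⟨(a, b), h⟩ := Subtype.ext rfl
    rw [this]
    change (e.symm (e ⟨(a, b), h⟩)).1.2 = b
    rw [e.symm_apply_apply]
  have hGH : ∀ p ∈ G, p ∈ H := fun p hp => G.le_topologicalClosure hp
  have hint : IntervalIntegrable du volume 0 T := by
    rw [intervalIntegrable_iff_integrableOn_Ioc_of_le hT.le]
    exact hdu.integrable (by norm_num)
  have hae : ∀ᵐ t ∂volume.restrict (Ioc 0 T), du t ∈ R :=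
    ae_mem_of_integral_mem hcl hint hu fun t ht => (hS _ _ (hGH _ (hy t ht))).1
  -- `S` acts only on `R`, so `du` is replaced by 0 where it leaves `R`; within `(0, T]` this
  -- changes it on a null set.
  let v : ℝ → R := fun t => if h : du t ∈ R then ⟨du t, h⟩ else 0
  have hv : (fun t => (v t : A)) =ᵐ[volume.restrict (Ioc 0 T)] du := by
    filter_upwards [hae] with t ht
    simp [v, ht]
  have hvm : MemLp v 2 (volume.restrict (Ioc 0 T)) := by
    have h1 : MemLp (fun t => (v t : A)) 2 (volume.restrict (Ioc 0 T)) := hdu.ae_eq hv.symm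
    refine ⟨?_, ?_⟩
    · exact (Topology.IsEmbedding.subtypeVal.aestronglyMeasurable_comp_iff).1 h1.1
    · exact h1.2
  have hvi : IntervalIntegrable v volume 0 T := by
    rw [intervalIntegrable_iff_integrableOn_Ioc_of_le hT.le]
    exact hvm.integrable (by norm_num)
  have : CompleteSpace R := hcl.completeSpace_coe
  refine ⟨fun t => S (v t), hvm.continuousLinearMap_comp S, fun t ht => ?_, ?_⟩
  · have h0 : (0 : ℝ) ∈ Icc 0 T := left_mem_Icc.2 hT.le
    obtain ⟨h1, h2⟩ := hS _ _ (hGH _ (hy t ht))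
    obtain ⟨h3, h4⟩ := hS _ _ (hGH _ (hy 0 h0))
    have hvt : IntervalIntegrable v volume 0 t := hvi.mono_set (by
      rw [uIcc_of_le ht.1, uIcc_of_le hT.le]; exact Icc_subset_Icc_right ht.2)
    rw [S.intervalIntegral_comp_comm hvt, ← h2, ← h4, ← map_add]
    congr 1
    refine Subtype.ext ?_
    change u t = u 0 + R.subtypeL (∫ s in (0 : ℝ)..t, v s)
    rw [← R.subtypeL.intervalIntegral_comp_comm hvt, hu t ht]
    congr 1
    rw [intervalIntegral.integral_of_le ht.1, intervalIntegral.integral_of_le ht.1]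
    refine integral_congr_ae ?_
    exact Filter.EventuallyEq.symm
      (ae_restrict_of_ae_restrict_of_subset (Ioc_subset_Ioc_right ht.2) hv)
  · filter_upwards [hv] with t ht
    have := hSH (v t)
    rw [ht] at this
    exact this

end TimeDerivative

/-! ### Representatives of `L²` classes and cut-off weights. -/

theorem toL2_coe {α F : Type} [MeasurableSpace α] [NormedAddCommGroup F] {μ : Measure α}
    {f : α → F} (h : MemLp f 2 μ) : toL2 μ f =ᵐ[μ] f := by
  rw [toL2, dif_pos h]
  exact h.coeFn_toLp

theorem eq_toL2 {α F : Type} [MeasurableSpace α] [NormedAddCommGroup F] {μ : Measure α}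
    {f : α → F} {x : Lp F 2 μ} (h : x =ᵐ[μ] f) : toL2 μ f = x :=
  Lp.ext ((toL2_coe ((Lp.memLp x).ae_eq h)).trans h.symm)

theorem setIntegral_eq_indicator_weight {α : Type*} [MeasurableSpace α] {μ : Measure α}
    {s t : Set α} (hs : MeasurableSet s) (hst : s ⊆ t) (w h : α → ℝ) :
    ∫ z in s, w z * h z ∂μ = ∫ z in t, s.indicator w z * h z ∂μ := by
  have : (fun z => s.indicator w z * h z) = s.indicator fun z => w z * h z := by
    ext z
    by_cases hz : z ∈ s <;> simp [hz]
  rw [this, setIntegral_indicator hs, inter_eq_right.2 hst]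

/-! ### Lipschitz functions in the matrix and along the fractures. -/

namespace MultiContinuum

variable {P : MultiContinuum}

theorem measurableSet_Ω : MeasurableSet P.Ω := P.isOpen_Ω.measurableSet

instance : IsFiniteMeasure P.μm :=
  ⟨by simpa using P.isBounded_Ω.measure_lt_top⟩

theorem measurable_path (l : Fin P.F) : Measurable (P.path l) :=
  (P.path_contDiff l).continuous.measurable

theorem measurableSet_fracIn (l : Fin P.F) {ω : Set Plane} (hω : MeasurableSet ω) :
    MeasurableSet (P.fracIn l ω) :=
  measurableSet_Ioo.inter (measurable_path l hω)

theorem path_lipschitz (l : Fin P.F) : LipschitzOnWith 1 (P.path l) (Ioo 0 (P.len l)) := by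
  refine Convex.lipschitzOnWith_of_nnnorm_deriv_le (𝕜 := ℝ)
    (fun x _ => ((P.path_contDiff l).differentiable one_ne_zero) x) (fun x hx => ?_)
    (convex_Ioo _ _)
  have := P.path_unit l x (Ioo_subset_Icc_self hx)
  exact_mod_cast this.le

theorem ext_ae {x y : P.X} (h1 : val x =ᵐ[P.μm] val y) (h2 : grad x =ᵐ[P.μm] grad y)
    (h3 : ∀ l, fval x l =ᵐ[P.μf l] fval y l) (h4 : ∀ l, fder x l =ᵐ[P.μf l] fder y l) : x = y :=
  Prod.ext (Lp.ext h1) (Prod.ext (Lp.ext h2) (Prod.ext (funext fun l => Lp.ext (h3 l))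
    (funext fun l => Lp.ext (h4 l))))

variable (P) in
/-- Lipschitz functions on the closure of the domain. -/
def Lip (χ : Plane → ℝ) : Prop := ∃ K : NNReal, LipschitzOnWith K χ (closure P.Ω)

namespace Lip

variable {χ φ : Plane → ℝ}

theorem lipschitzOnWith (h : P.Lip χ) : ∃ K : NNReal, LipschitzOnWith K χ P.Ω :=
  h.imp fun _ hK => hK.mono subset_closure

theorem lipschitzOnWith_path (h : P.Lip χ) (l : Fin P.F) :
    ∃ K : NNReal, LipschitzOnWith K (χ ∘ P.path l) (Ioo 0 (P.len l)) := by
  obtain ⟨K, hK⟩ := h.lipschitzOnWith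
  exact ⟨K * 1, hK.comp (path_lipschitz l) (P.path_mem l)⟩

theorem bounded (h : P.Lip χ) : ∃ C, ∀ z ∈ closure P.Ω, ‖χ z‖ ≤ C := by
  obtain ⟨K, hK⟩ := h
  exact (P.isBounded_Ω.isCompact_closure).exists_bound_of_continuousOn hK.continuousOn

theorem mul (h : P.Lip χ) (h' : P.Lip φ) : P.Lip fun z => χ z * φ z := by
  obtain ⟨C, hC⟩ := h.bounded
  obtain ⟨C', hC'⟩ := h'.bounded
  obtain ⟨K, hK⟩ := h
  obtain ⟨K', hK'⟩ := h'
  refine ⟨Real.toNNReal (C * K' + C' * K), LipschitzOnWith.of_dist_le_mul fun x hx y hy => ?_⟩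
  have h1 := hK.dist_le_mul x hx y hy
  have h2 := hK'.dist_le_mul x hx y hy
  rw [Real.dist_eq] at h1 h2 ⊢
  have e : χ x * φ x - χ y * φ y = χ x * (φ x - φ y) + φ y * (χ x - χ y) := by ring
  calc |χ x * φ x - χ y * φ y| ≤ |χ x| * |φ x - φ y| + |φ y| * |χ x - χ y| := by
        rw [e, ← abs_mul, ← abs_mul]; exact abs_add_le _ _
    _ ≤ C * (K' * dist x y) + C' * (K * dist x y) := by
        refine add_le_add (mul_le_mul (hC x hx) h2 (abs_nonneg _) ?_)
          (mul_le_mul (hC' y hy) h1 (abs_nonneg _) ?_)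
        · exact (norm_nonneg _).trans (hC x hx)
        · exact (norm_nonneg _).trans (hC' y hy)
    _ = (C * K' + C' * K) * dist x y := by ring
    _ ≤ _ := mul_le_mul_of_nonneg_right (Real.le_coe_toNNReal _) dist_nonneg

/-- Rademacher's theorem; openness of `Ω` turns differentiability within `Ω` into differentiability.
-/
theorem ae_differentiableAt (h : P.Lip χ) : ∀ᵐ z ∂P.μm, DifferentiableAt ℝ χ z := by
  obtain ⟨K, hK⟩ := h.lipschitzOnWith
  filter_upwards [hK.ae_differentiableWithinAt measurableSet_Ω, ae_restrict_mem measurableSet_Ω]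
    with z hz hm
  exact hz.differentiableAt (P.isOpen_Ω.mem_nhds hm)

theorem ae_differentiableAt_path (h : P.Lip χ) (l : Fin P.F) :
    ∀ᵐ s ∂P.μf l, DifferentiableAt ℝ (χ ∘ P.path l) s := by
  obtain ⟨K, hK⟩ := h.lipschitzOnWith_path l
  filter_upwards [hK.ae_differentiableWithinAt measurableSet_Ioo, ae_restrict_mem measurableSet_Ioo]
    with z hz hm
  exact hz.differentiableAt (isOpen_Ioo.mem_nhds hm)

theorem essBdd (h : P.Lip χ) : EssBdd P.μm χ := by
  obtain ⟨C, hC⟩ := h.bounded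
  obtain ⟨K, hK⟩ := h.lipschitzOnWith
  refine ⟨hK.continuousOn.aestronglyMeasurable measurableSet_Ω, C, ?_⟩
  filter_upwards [ae_restrict_mem measurableSet_Ω] with z hz
  exact hC z (subset_closure hz)

theorem essBdd_gradient (h : P.Lip χ) : EssBdd P.μm (gradient χ) := by
  obtain ⟨K, hK⟩ := h.lipschitzOnWith
  refine ⟨?_, K, ?_⟩
  · exact (((InnerProductSpace.toDual ℝ Plane).symm.continuous.measurable).comp
      (measurable_fderiv ℝ χ)).aestronglyMeasurable
  · filter_upwards [ae_restrict_mem measurableSet_Ω] with z hz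
    rw [gradient, LinearIsometryEquiv.norm_map]
    exact norm_fderiv_le_of_lipschitzOn ℝ (P.isOpen_Ω.mem_nhds hz) hK

theorem essBdd_path (h : P.Lip χ) (l : Fin P.F) : EssBdd (P.μf l) (χ ∘ P.path l) := by
  obtain ⟨C, hC⟩ := h.bounded
  obtain ⟨K, hK⟩ := h.lipschitzOnWith_path l
  refine ⟨hK.continuousOn.aestronglyMeasurable measurableSet_Ioo, C, ?_⟩
  filter_upwards [ae_restrict_mem measurableSet_Ioo] with z hz
  exact hC _ (subset_closure (P.path_mem l z hz))

theorem essBdd_deriv (h : P.Lip χ) (l : Fin P.F) : EssBdd (P.μf l) (deriv (χ ∘ P.path l)) := by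
  obtain ⟨K, hK⟩ := h.lipschitzOnWith_path l
  refine ⟨(measurable_deriv _).aestronglyMeasurable, K, ?_⟩
  filter_upwards [ae_restrict_mem measurableSet_Ioo] with z hz
  exact norm_deriv_le_of_lipschitzOn (isOpen_Ioo.mem_nhds hz) hK

end Lip

/-! ### Components of the generators of `H¹`. -/

section Embed

variable {ω : Set Plane} {φ : Plane → ℝ}

theorem val_embed (hω : MeasurableSet ω) (h : P.Lip φ) :
    val (P.embed ω φ) =ᵐ[P.μm] ω.indicator φ :=
  toL2_coe ((h.essBdd.indicator hω).memLp 2)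

theorem grad_embed (hω : MeasurableSet ω) (h : P.Lip φ) :
    grad (P.embed ω φ) =ᵐ[P.μm] ω.indicator (gradient φ) :=
  toL2_coe ((h.essBdd_gradient.indicator hω).memLp 2)

theorem fval_embed (hω : MeasurableSet ω) (h : P.Lip φ) (l : Fin P.F) :
    fval (P.embed ω φ) l =ᵐ[P.μf l] (P.path l ⁻¹' ω).indicator (φ ∘ P.path l) :=
  toL2_coe (((h.essBdd_path l).indicator (measurable_path l hω)).memLp 2)

theorem fder_embed (hω : MeasurableSet ω) (h : P.Lip φ) (l : Fin P.F) :
    fder (P.embed ω φ) l =ᵐ[P.μf l] (P.path l ⁻¹' ω).indicator (deriv (φ ∘ P.path l)) :=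
  toL2_coe (((h.essBdd_deriv l).indicator (measurable_path l hω)).memLp 2)

end Embed

/-! ### Multiplication by Lipschitz functions. -/

section Mul

variable {χ : Plane → ℝ}

theorem val_mul (h : P.Lip χ) (x : P.X) :
    val (P.mul χ x) =ᵐ[P.μm] fun z => χ z * val x z :=
  toL2_coe (h.essBdd.memLp_smul (Lp.memLp x.1))

theorem memLp_smul_gradient (h : P.Lip χ) (x : P.X) :
    MemLp (fun z => val x z • gradient χ z) 2 P.μm :=
  (h.essBdd_gradient.comp_clm (ContinuousLinearMap.smulRightL ℝ ℝ Plane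
    (ContinuousLinearMap.id ℝ ℝ))).memLp_apply (Lp.memLp x.1)

theorem grad_mul (h : P.Lip χ) (x : P.X) :
    grad (P.mul χ x) =ᵐ[P.μm] fun z => χ z • grad x z + val x z • gradient χ z :=
  toL2_coe ((h.essBdd.memLp_smul (Lp.memLp x.2.1)).add (memLp_smul_gradient h x))

theorem fval_mul (h : P.Lip χ) (x : P.X) (l : Fin P.F) :
    fval (P.mul χ x) l =ᵐ[P.μf l] fun s => χ (P.path l s) * fval x l s :=
  toL2_coe ((h.essBdd_path l).memLp_smul (Lp.memLp (x.2.2.1 l)))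

theorem fder_mul (h : P.Lip χ) (x : P.X) (l : Fin P.F) :
    fder (P.mul χ x) l =ᵐ[P.μf l] fun s =>
      χ (P.path l s) * fder x l s + fval x l s * deriv (χ ∘ P.path l) s := by
  refine toL2_coe (((h.essBdd_path l).memLp_smul (Lp.memLp (x.2.2.2 l))).add ?_)
  have := (h.essBdd_deriv l).memLp_smul (Lp.memLp (x.2.2.1 l))
  simpa [mul_comm] using this

/-- `mul` is built from representatives, so linearity and continuity are not visible in its
definition; they come from assembling bounded multipliers componentwise. -/
theorem exists_mulL (h : P.Lip χ) : ∃ T : P.X →L[ℝ] P.X, ∀ x, P.mul χ x = T x := by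
  obtain ⟨T1, h1⟩ := h.essBdd.exists_clm_smul (F := ℝ)
  obtain ⟨T2, h2⟩ := h.essBdd.exists_clm_smul (F := Plane)
  obtain ⟨T3, h3⟩ := (h.essBdd_gradient.comp_clm (ContinuousLinearMap.smulRightL ℝ ℝ Plane
    (ContinuousLinearMap.id ℝ ℝ))).exists_clm
  choose T4 h4 using fun l => (h.essBdd_path l).exists_clm_smul (F := ℝ)
  choose T5 h5 using fun l => (h.essBdd_deriv l).exists_clm_smul (F := ℝ)
  let p1 : P.X →L[ℝ] _ := ContinuousLinearMap.fst ℝ _ _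
  let q1 : P.X →L[ℝ] _ := ContinuousLinearMap.snd ℝ _ _
  let p2 : P.X →L[ℝ] _ := (ContinuousLinearMap.fst ℝ _ _).comp q1
  let q2 : P.X →L[ℝ] _ := (ContinuousLinearMap.snd ℝ _ _).comp q1
  let p3 : P.X →L[ℝ] _ := (ContinuousLinearMap.fst ℝ _ _).comp q2
  let p4 : P.X →L[ℝ] _ := (ContinuousLinearMap.snd ℝ _ _).comp q2
  let p3' (l : Fin P.F) : P.X →L[ℝ] _ := (ContinuousLinearMap.proj l).comp p3
  let p4' (l : Fin P.F) : P.X →L[ℝ] _ := (ContinuousLinearMap.proj l).comp p4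
  refine ⟨(T1.comp p1).prod ((T2.comp p2 + T3.comp p1).prod
    ((ContinuousLinearMap.pi fun l => (T4 l).comp (p3' l)).prod
      (ContinuousLinearMap.pi fun l => (T4 l).comp (p4' l) + (T5 l).comp (p3' l)))), fun x => ?_⟩
  refine Prod.ext (eq_toL2 (h1 x.1)) (Prod.ext (eq_toL2 ?_) (Prod.ext (funext fun l =>
    eq_toL2 (h4 l (x.2.2.1 l))) (funext fun l => eq_toL2 ?_)))
  · change (T2 x.2.1 + T3 x.1 : Lp Plane 2 P.μm) =ᵐ[P.μm] _
    filter_upwards [Lp.coeFn_add (T2 x.2.1) (T3 x.1), h2 x.2.1, h3 x.1] with z e1 e2 e3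
    rw [e1, Pi.add_apply, e2, e3]
    simp
  · change (T4 l (x.2.2.2 l) + T5 l (x.2.2.1 l) : Lp ℝ 2 (P.μf l)) =ᵐ[P.μf l] _
    filter_upwards [Lp.coeFn_add (T4 l (x.2.2.2 l)) (T5 l (x.2.2.1 l)), h4 l (x.2.2.2 l),
      h5 l (x.2.2.1 l)] with z e1 e2 e3
    rw [e1, Pi.add_apply, e2, e3]
    simp [mul_comm]

theorem mul_embed {ω : Set Plane} (hω : MeasurableSet ω) {φ : Plane → ℝ} (h : P.Lip χ)
    (hφ : P.Lip φ) : P.mul χ (P.embed ω φ) = P.embed ω fun z => χ z * φ z := by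
  have h' := h.mul hφ
  refine ext_ae ?_ ?_ (fun l => ?_) fun l => ?_
  · filter_upwards [val_mul h (P.embed ω φ), val_embed hω hφ, val_embed hω h'] with z e1 e2 e3
    rw [e1, e2, e3]
    by_cases hz : z ∈ ω <;> simp [hz]
  · filter_upwards [grad_mul h (P.embed ω φ), val_embed hω hφ, grad_embed hω hφ,
      grad_embed hω h', h.ae_differentiableAt, hφ.ae_differentiableAt] with z e1 e2 e3 e4 d1 d2
    rw [e1, e2, e3, e4]
    by_cases hz : z ∈ ω
    · simp [hz, gradient, fderiv_fun_mul d1 d2]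
    · simp [hz]
  · filter_upwards [fval_mul h (P.embed ω φ) l, fval_embed hω hφ l, fval_embed hω h' l]
      with z e1 e2 e3
    rw [e1, e2, e3]
    by_cases hz : P.path l z ∈ ω <;> simp [hz]
  · filter_upwards [fder_mul h (P.embed ω φ) l, fval_embed hω hφ l, fder_embed hω hφ l,
      fder_embed hω h' l, h.ae_differentiableAt_path l, hφ.ae_differentiableAt_path l]
      with z e1 e2 e3 e4 d1 d2
    rw [e1, e2, e3, e4]
    by_cases hz : P.path l z ∈ ω
    · have : ((fun z => χ z * φ z) ∘ P.path l) = fun s => (χ ∘ P.path l) s * (φ ∘ P.path l) s :=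
        rfl
      rw [this, indicator_of_mem (by exact hz), indicator_of_mem (by exact hz),
        indicator_of_mem (by exact hz), deriv_fun_mul d1 d2]
      simp only [Function.comp]
      ring
    · simp [hz]

/-- By continuity of the multiplication it suffices to treat the Lipschitz generators, where it is
the ordinary product (`mul_embed`) and the zeros of both factors count. -/
theorem mul_mem_H1 {ω Z Z' : Set Plane} (hω : MeasurableSet ω) (h : P.Lip χ)
    (hZ : ∀ z ∈ Z', z ∈ Z ∨ χ z = 0) {x : P.X} (hx : x ∈ P.H1 ω Z) : P.mul χ x ∈ P.H1 ω Z' := by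
  obtain ⟨T, hT⟩ := exists_mulL h
  have hc : IsClosed (P.H1 ω Z' : Set P.X) := Submodule.isClosed_topologicalClosure _
  suffices H : P.H1 ω Z ≤ (P.H1 ω Z').comap (T : P.X →ₗ[ℝ] P.X) by
    have := H hx
    rw [hT]
    exact this
  refine Submodule.topologicalClosure_minimal _ (Submodule.span_le.2 ?_) (hc.preimage T.continuous)
  rintro _ ⟨φ, K, hφ, h0, rfl⟩
  change T _ ∈ P.H1 ω Z'
  rw [← hT, mul_embed hω h ⟨K, hφ⟩]
  obtain ⟨K', hK'⟩ := h.mul ⟨K, hφ⟩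
  refine Submodule.le_topologicalClosure _ (Submodule.subset_span ⟨_, K', hK', ?_, rfl⟩)
  intro z hz
  rcases hZ z hz with h1 | h1
  · simp [h0 z h1]
  · simp [h1]

end Mul

/-! ### Restriction to a region and supports. -/

section Restr

variable {ω : Set Plane}

theorem val_restr (hω : MeasurableSet ω) (x : P.X) :
    val (P.restr ω x) =ᵐ[P.μm] ω.indicator (val x) :=
  toL2_coe ((Lp.memLp x.1).indicator hω)

theorem grad_restr (hω : MeasurableSet ω) (x : P.X) :
    grad (P.restr ω x) =ᵐ[P.μm] ω.indicator (grad x) :=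
  toL2_coe ((Lp.memLp x.2.1).indicator hω)

theorem fval_restr (hω : MeasurableSet ω) (x : P.X) (l : Fin P.F) :
    fval (P.restr ω x) l =ᵐ[P.μf l] (P.path l ⁻¹' ω).indicator (fval x l) :=
  toL2_coe ((Lp.memLp (x.2.2.1 l)).indicator (measurable_path l hω))

theorem fder_restr (hω : MeasurableSet ω) (x : P.X) (l : Fin P.F) :
    fder (P.restr ω x) l =ᵐ[P.μf l] (P.path l ⁻¹' ω).indicator (fder x l) :=
  toL2_coe ((Lp.memLp (x.2.2.2 l)).indicator (measurable_path l hω))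

theorem exists_restrL (hω : MeasurableSet ω) : ∃ T : P.X →L[ℝ] P.X, ∀ x, P.restr ω x = T x := by
  have hb : ∀ {α : Type} [MeasurableSpace α] (μ : Measure α) {s : Set α}, MeasurableSet s →
      EssBdd μ (s.indicator fun _ => (1 : ℝ)) := fun μ s hs =>
    EssBdd.indicator ⟨aestronglyMeasurable_const, 1, by simp⟩ hs
  have hi : ∀ {α F : Type} [NormedAddCommGroup F] [NormedSpace ℝ F] (s : Set α) (f : α → F),
      (fun z => s.indicator (fun _ => (1 : ℝ)) z • f z) = s.indicator f := fun s f => by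
    ext z
    by_cases hz : z ∈ s <;> simp [hz]
  obtain ⟨T1, h1⟩ := (hb P.μm hω).exists_clm_smul (F := ℝ)
  obtain ⟨T2, h2⟩ := (hb P.μm hω).exists_clm_smul (F := Plane)
  choose T4 h4 using fun l => (hb (P.μf l) (measurable_path l hω)).exists_clm_smul (F := ℝ)
  simp only [hi] at h1 h2 h4
  exact ⟨T1.prodMap (T2.prodMap ((ContinuousLinearMap.pi fun l =>
    (T4 l).comp (ContinuousLinearMap.proj l)).prodMap (ContinuousLinearMap.pi fun l =>
      (T4 l).comp (ContinuousLinearMap.proj l)))), fun x =>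
    Prod.ext (eq_toL2 (h1 x.1)) (Prod.ext (eq_toL2 (h2 _)) (Prod.ext (funext fun l =>
      eq_toL2 (h4 l (x.2.2.1 l))) (funext fun l => eq_toL2 (h4 l (x.2.2.2 l)))))⟩

theorem restr_embed (hω : MeasurableSet ω) {φ : Plane → ℝ} (hφ : P.Lip φ) :
    P.restr ω (P.embed ω φ) = P.embed ω φ := by
  have key : ∀ {α F : Type} [MeasurableSpace α] [NormedAddCommGroup F] {μ : Measure α}
      {s : Set α} {f g : α → F}, f =ᵐ[μ] s.indicator g → f =ᵐ[μ] s.indicator f := by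
    intro α F _ _ μ s f g h
    filter_upwards [h] with z hz
    by_cases h' : z ∈ s <;> simp_all
  exact Prod.ext (eq_toL2 (key (val_embed hω hφ))) (Prod.ext (eq_toL2 (key (grad_embed hω hφ)))
    (Prod.ext (funext fun l => eq_toL2 (key (fval_embed hω hφ l)))
      (funext fun l => eq_toL2 (key (fder_embed hω hφ l)))))

/-- The equation holds for the generators, which are extended by zero, and it is a closed linear
condition. -/
theorem restr_eq_self {Z : Set Plane} (hω : MeasurableSet ω) {x : P.X} (hx : x ∈ P.H1 ω Z) :
    P.restr ω x = x := by
  obtain ⟨T, hT⟩ := exists_restrL (P := P) hω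
  suffices H : P.H1 ω Z ≤ LinearMap.eqLocus (T : P.X →ₗ[ℝ] P.X) LinearMap.id by
    rw [hT]; exact H hx
  refine Submodule.topologicalClosure_minimal _ (Submodule.span_le.2 ?_)
    (isClosed_eq T.continuous continuous_id)
  rintro _ ⟨φ, K, hφ, h0, rfl⟩
  change T _ = _
  rw [← hT]
  exact restr_embed hω ⟨K, hφ⟩

theorem ae_eq_zero_of_restr_eq_self (hω : MeasurableSet ω) {x : P.X} (hx : P.restr ω x = x) :
    (∀ᵐ z ∂P.μm, z ∉ ω → val x z = 0 ∧ grad x z = 0) ∧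
      ∀ l, ∀ᵐ s ∂P.μf l, P.path l s ∉ ω → fval x l s = 0 ∧ fder x l s = 0 := by
  have h1 := val_restr hω x
  have h2 := grad_restr hω x
  have h3 := fval_restr hω x
  have h4 := fder_restr hω x
  rw [hx] at h1 h2 h3 h4
  refine ⟨?_, fun l => ?_⟩
  · filter_upwards [h1, h2] with z e1 e2 hz
    rw [e1, e2]
    simp [hz]
  · filter_upwards [h3 l, h4 l] with z e1 e2 hz
    rw [e1, e2]
    simp [hz]

end Restr

end MultiContinuum

/-! ### Scalar weighted integrals and coercivity. -/

section RealWeighted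

variable {α : Type*} [MeasurableSpace α] {μ : Measure α}

theorem mul_mul_eq_inner (w x y : ℝ) : w * x * y = w * inner ℝ x y := by
  simp only [RCLike.inner_apply, conj_trivial]
  ring

theorem EssBdd.integrable_mul {w : α → ℝ} (h : EssBdd μ w) {x y : α → ℝ} (hx : MemLp x 2 μ)
    (hy : MemLp y 2 μ) : Integrable (fun z => w z * x z * y z) μ := by
  simpa only [mul_mul_eq_inner] using h.integrable_inner hx hy

theorem mul_norm_sq_le_integral {F : Type*} [NormedAddCommGroup F] [InnerProductSpace ℝ F]
    {w : α → ℝ} (h : EssBdd μ w) {c : ℝ} (hc : ∀ᵐ z ∂μ, c ≤ w z) (x : Lp F 2 μ) :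
    c * ‖x‖ ^ 2 ≤ ∫ z, w z * inner ℝ (x z) (x z) ∂μ := by
  rw [← real_inner_self_eq_norm_sq, L2.inner_def, ← integral_const_mul]
  refine integral_mono_ae ((L2.integrable_inner (𝕜 := ℝ) x x).const_mul c)
    (h.integrable_inner (Lp.memLp x) (Lp.memLp x)) ?_
  filter_upwards [hc] with z hz
  exact mul_le_mul_of_nonneg_right hz real_inner_self_nonneg

end RealWeighted

/-! ### Boundedness of the coefficients; continuity and coercivity of the forms. -/

namespace MultiContinuum

variable {P : MultiContinuum}

section Coefficients

theorem essBdd_of_mem_Icc {α : Type*} [MeasurableSpace α] {μ : Measure α} {s : Set α}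
    (hs : MeasurableSet s) {w : α → ℝ} (hw : Measurable w) {a b : ℝ}
    (h : ∀ z ∈ s, w z ∈ Icc a b) : EssBdd (μ.restrict s) w := by
  refine ⟨hw.aestronglyMeasurable, max |a| |b|, ?_⟩
  filter_upwards [ae_restrict_mem hs] with z hz
  exact abs_le_max_abs_abs (h z hz).1 (h z hz).2

theorem essBdd_c (i : Fin P.N) : EssBdd P.μm (P.c i) :=
  essBdd_of_mem_Icc measurableSet_Ω (P.measurable_c i) (P.c_mem i)

theorem essBdd_κ (i : Fin P.N) : EssBdd P.μm (P.κ i) :=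
  essBdd_of_mem_Icc measurableSet_Ω (P.measurable_κ i) (P.κ_mem i)

theorem essBdd_cF (l : Fin P.F) (i : Fin P.N) : EssBdd (P.μf l) (P.cF l i) :=
  essBdd_of_mem_Icc measurableSet_Ioo (P.measurable_cF l i) (P.cF_mem l i)

theorem essBdd_κF (l : Fin P.F) (i : Fin P.N) : EssBdd (P.μf l) (P.κF l i) :=
  essBdd_of_mem_Icc measurableSet_Ioo (P.measurable_κF l i) (P.κF_mem l i)

theorem ae_lo_le_c (i : Fin P.N) : ∀ᵐ z ∂P.μm, P.lo ≤ P.c i z := by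
  filter_upwards [ae_restrict_mem measurableSet_Ω] with z hz using (P.c_mem i z hz).1

theorem ae_lo_le_κ (i : Fin P.N) : ∀ᵐ z ∂P.μm, P.lo ≤ P.κ i z := by
  filter_upwards [ae_restrict_mem measurableSet_Ω] with z hz using (P.κ_mem i z hz).1

theorem ae_lo_le_cF (l : Fin P.F) (i : Fin P.N) : ∀ᵐ s ∂P.μf l, P.lo ≤ P.cF l i s := by
  filter_upwards [ae_restrict_mem measurableSet_Ioo] with z hz using (P.cF_mem l i z hz).1

theorem ae_lo_le_κF (l : Fin P.F) (i : Fin P.N) : ∀ᵐ s ∂P.μf l, P.lo ≤ P.κF l i s := by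
  filter_upwards [ae_restrict_mem measurableSet_Ioo] with z hz using (P.κF_mem l i z hz).1

end Coefficients

section Forms

variable (P) in
/-- value in the matrix, as an operator -/
noncomputable def valL : P.X →L[ℝ] Lp ℝ 2 P.μm := ContinuousLinearMap.fst ℝ _ _

variable (P) in
/-- gradient in the matrix, as an operator -/
noncomputable def gradL : P.X →L[ℝ] Lp Plane 2 P.μm :=
  (ContinuousLinearMap.fst ℝ _ _).comp (ContinuousLinearMap.snd ℝ _ _)

/-- value on a fracture, as an operator -/
noncomputable def fvalL (l : Fin P.F) : P.X →L[ℝ] Lp ℝ 2 (P.μf l) :=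
  (ContinuousLinearMap.proj l).comp ((ContinuousLinearMap.fst ℝ _ _).comp
    ((ContinuousLinearMap.snd ℝ _ _).comp (ContinuousLinearMap.snd ℝ _ _)))

/-- derivative along a fracture, as an operator -/
noncomputable def fderL (l : Fin P.F) : P.X →L[ℝ] Lp ℝ 2 (P.μf l) :=
  (ContinuousLinearMap.proj l).comp ((ContinuousLinearMap.snd ℝ _ _).comp
    ((ContinuousLinearMap.snd ℝ _ _).comp (ContinuousLinearMap.snd ℝ _ _)))

variable {ω : Set Plane}

theorem fracIn_subset (l : Fin P.F) (ω : Set Plane) : P.fracIn l ω ⊆ Ioo 0 (P.len l) :=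
  inter_subset_left

theorem fracIn_Ω (l : Fin P.F) : P.fracIn l P.Ω = Ioo 0 (P.len l) :=
  inter_eq_left.2 fun s hs => P.path_mem l s hs

theorem isContBilin_cForm (i : Fin P.N) : IsContBilin (cForm i : P.X → P.X → ℝ) :=
  ((essBdd_c i).isContBilin_mul.comp (valL P)).add
    (IsContBilin.sum _ fun l => (essBdd_cF l i).isContBilin_mul.comp (fvalL l))

/-- An integral over `ω` is one over `Ω` with the weight cut off to `ω`, which is still essentially
bounded. -/
theorem isContBilin_aLoc (hω : MeasurableSet ω) (hs : ω ⊆ P.Ω) (i : Fin P.N) :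
    IsContBilin (aLoc ω i : P.X → P.X → ℝ) := by
  have h := (((essBdd_κ i).indicator hω).isContBilin_inner.comp (gradL P)).add
    (IsContBilin.sum Finset.univ fun l =>
      ((essBdd_κF l i).indicator (measurableSet_fracIn l hω)).isContBilin_mul.comp (fderL l))
  convert h using 3 with x y
  refine congr_arg₂ _ (setIntegral_eq_indicator_weight hω hs _ _)
    (Finset.sum_congr rfl fun l _ => ?_)
  have := setIntegral_eq_indicator_weight (μ := volume) (measurableSet_fracIn l hω)
    (fracIn_subset l ω) (P.κF l i) fun s => fder x l s * fder y l s
  simp only [mul_assoc] at this ⊢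
  exact this

theorem isContBilin_aForm (i : Fin P.N) : IsContBilin (aForm i : P.X → P.X → ℝ) :=
  isContBilin_aLoc measurableSet_Ω subset_rfl i

theorem Coarse.isContBilin_sForm (G : Coarse P) (j : Fin G.m) (i : Fin P.N) :
    IsContBilin (G.sForm j i) := by
  have hω := (G.isOpen_ω j).measurableSet
  have hχ : P.Lip (G.χ j) := G.χ_lipschitz j
  have h := ((((essBdd_κ i).mul hχ.essBdd_gradient.norm_sq).indicator
    hω).isContBilin_mul.comp (valL P)).add
    (IsContBilin.sum Finset.univ fun l =>
      (((essBdd_κF l i).mul (hχ.essBdd_deriv l).norm_sq).indicator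
        (measurableSet_fracIn l hω)).isContBilin_mul.comp (fvalL l))
  convert h using 3 with x y
  refine congr_arg₂ _ ?_ (Finset.sum_congr rfl fun l _ => ?_)
  · have := setIntegral_eq_indicator_weight (μ := volume) hω (G.ω_subset j)
      (fun z => P.κ i z * ‖gradient (G.χ j) z‖ ^ 2) fun z => val x z * val y z
    simp only [mul_assoc] at this ⊢
    exact this
  · have := setIntegral_eq_indicator_weight (μ := volume) (measurableSet_fracIn l hω)
      (fracIn_subset l (G.ω j)) (fun s => P.κF l i s * ‖deriv (G.χ j ∘ P.path l) s‖ ^ 2)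
      fun s => fval x l s * fval y l s
    simp only [mul_assoc, Real.norm_eq_abs, sq_abs] at this ⊢
    exact this

theorem aLoc_comm (ω : Set Plane) (i : Fin P.N) (x y : P.X) : aLoc ω i x y = aLoc ω i y x := by
  simp only [aLoc, real_inner_comm, mul_assoc, mul_comm (fder x _ _)]

theorem aLoc_nonneg (hω : MeasurableSet ω) (hs : ω ⊆ P.Ω) (i : Fin P.N) (x : P.X) :
    0 ≤ aLoc ω i x x := by
  refine add_nonneg ?_ (Finset.sum_nonneg fun l _ => ?_)
  · exact setIntegral_nonneg hω fun z hz =>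
      mul_nonneg (P.lo_pos.le.trans (P.κ_mem i z (hs hz)).1) real_inner_self_nonneg
  · refine setIntegral_nonneg (measurableSet_fracIn l hω) fun s hs => ?_
    rw [mul_assoc]
    exact mul_nonneg (P.lo_pos.le.trans (P.κF_mem l i s hs.1).1) (mul_self_nonneg _)

theorem cForm_nonneg (i : Fin P.N) (x : P.X) : 0 ≤ cForm i x x := by
  refine add_nonneg ?_ (Finset.sum_nonneg fun l _ => ?_)
  · refine setIntegral_nonneg measurableSet_Ω fun z hz => ?_
    rw [mul_assoc]
    exact mul_nonneg (P.lo_pos.le.trans (P.c_mem i z hz).1) (mul_self_nonneg _)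
  · refine setIntegral_nonneg measurableSet_Ioo fun s hs => ?_
    rw [mul_assoc]
    exact mul_nonneg (P.lo_pos.le.trans (P.cF_mem l i s hs).1) (mul_self_nonneg _)

theorem aForm_nonneg (i : Fin P.N) (x : P.X) : 0 ≤ aForm i x x :=
  aLoc_nonneg measurableSet_Ω subset_rfl i x

theorem Coarse.sForm_nonneg (G : Coarse P) (j : Fin G.m) (i : Fin P.N) (x : P.X) :
    0 ≤ G.sForm j i x x := by
  have hω := (G.isOpen_ω j).measurableSet
  refine add_nonneg ?_ (Finset.sum_nonneg fun l _ => ?_)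
  · refine setIntegral_nonneg hω fun z hz => ?_
    have := P.lo_pos.le.trans (P.κ_mem i z (G.ω_subset j hz)).1
    rw [mul_assoc]
    exact mul_nonneg (by positivity) (mul_self_nonneg _)
  · refine setIntegral_nonneg (measurableSet_fracIn l hω) fun s hs => ?_
    have := P.lo_pos.le.trans (P.κF_mem l i s hs.1).1
    rw [mul_assoc]
    exact mul_nonneg (by positivity) (mul_self_nonneg _)

/-- The forms `c_i` and `a_i` together control the norm. -/
theorem lo_mul_norm_sq_le (i : Fin P.N) (x : P.X) :
    P.lo * ‖x‖ ^ 2 ≤ cForm i x x + aForm i x x := by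
  have h1 := mul_norm_sq_le_integral (essBdd_c i) (ae_lo_le_c i) x.1
  have h2 := mul_norm_sq_le_integral (essBdd_κ i) (ae_lo_le_κ i) x.2.1
  have h3 := fun l => mul_norm_sq_le_integral (essBdd_cF l i) (ae_lo_le_cF l i) (x.2.2.1 l)
  have h4 := fun l => mul_norm_sq_le_integral (essBdd_κF l i) (ae_lo_le_κF l i) (x.2.2.2 l)
  set I1 := ∫ z in P.Ω, P.c i z * inner ℝ (val x z) (val x z) with hI1
  set I2 := ∫ z in P.Ω, P.κ i z * inner ℝ (grad x z) (grad x z) with hI2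
  set I3 := fun l => ∫ s in Ioo 0 (P.len l), P.cF l i s * inner ℝ (fval x l s) (fval x l s)
    with hI3
  set I4 := fun l => ∫ s in Ioo 0 (P.len l), P.κF l i s * inner ℝ (fder x l s) (fder x l s)
    with hI4
  have e : cForm i x x + aForm i x x = I1 + ∑ l, I3 l + (I2 + ∑ l, I4 l) := by
    simp only [cForm, aForm, aLoc, fracIn_Ω, mul_mul_eq_inner, hI1, hI2, hI3, hI4]
  have hlo := P.lo_pos
  have p1 : 0 ≤ I1 := le_trans (by positivity) h1
  have p2 : 0 ≤ I2 := le_trans (by positivity) h2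
  have p3 : ∀ l, 0 ≤ I3 l := fun l => le_trans (by positivity) (h3 l)
  have p4 : ∀ l, 0 ≤ I4 l := fun l => le_trans (by positivity) (h4 l)
  have s3 : ∀ l, I3 l ≤ ∑ l, I3 l := fun l =>
    Finset.single_le_sum (fun l _ => p3 l) (Finset.mem_univ l)
  have s4 : ∀ l, I4 l ≤ ∑ l, I4 l := fun l =>
    Finset.single_le_sum (fun l _ => p4 l) (Finset.mem_univ l)
  have q3 : 0 ≤ ∑ l, I3 l := Finset.sum_nonneg fun l _ => p3 l
  have q4 : 0 ≤ ∑ l, I4 l := Finset.sum_nonneg fun l _ => p4 l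
  rw [e]
  set R := I1 + ∑ l, I3 l + (I2 + ∑ l, I4 l) with hR
  have hR0 : 0 ≤ R := by positivity
  -- The norm of `P.X` is the maximum of the component norms, so each component is bounded
  -- separately by the same square root.
  have key : ∀ t : ℝ, 0 ≤ t → P.lo * t ^ 2 ≤ R → t ≤ √(R / P.lo) := fun t ht h => by
    rw [Real.le_sqrt ht (by positivity), le_div_iff₀ hlo]
    linarith
  have hn : ‖x‖ ≤ √(R / P.lo) := by
    refine norm_prod_le_iff.2 ⟨key _ (norm_nonneg _) ?_, norm_prod_le_iff.2
      ⟨key _ (norm_nonneg _) ?_, norm_prod_le_iff.2 ⟨?_, ?_⟩⟩⟩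
    · exact h1.trans (by change I1 ≤ R; linarith)
    · exact h2.trans (by change I2 ≤ R; linarith)
    · refine (pi_norm_le_iff_of_nonneg (Real.sqrt_nonneg _)).2 fun l =>
        key _ (norm_nonneg _) ((h3 l).trans ?_)
      have := s3 l
      change I3 l ≤ R
      linarith
    · refine (pi_norm_le_iff_of_nonneg (Real.sqrt_nonneg _)).2 fun l =>
        key _ (norm_nonneg _) ((h4 l).trans ?_)
      have := s4 l
      change I4 l ≤ R
      linarith
  have := (Real.le_sqrt (norm_nonneg x) (by positivity)).1 hn
  rw [le_div_iff₀ hlo] at this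
  linarith

end Forms

/-! ### Localization of the forms and the energy of a product. -/

section Support

variable {ω : Set Plane}

theorem aForm_eq_aLoc (hω : MeasurableSet ω) (hs : ω ⊆ P.Ω) (i : Fin P.N) {y : P.X}
    (hy : P.restr ω y = y) (x : P.X) : aForm i x y = aLoc ω i x y := by
  obtain ⟨h1, h2⟩ := ae_eq_zero_of_restr_eq_self hω hy
  refine congr_arg₂ _ ?_ (Finset.sum_congr rfl fun l _ => ?_)
  · refine setIntegral_eq_of_subset_of_ae_sdiff_eq_zero measurableSet_Ω.nullMeasurableSet hs ?_
    filter_upwards [(ae_restrict_iff' measurableSet_Ω).1 h1] with z hz hm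
    rw [(hz hm.1 hm.2).2, inner_zero_right, mul_zero]
  · rw [fracIn_Ω]
    refine setIntegral_eq_of_subset_of_ae_sdiff_eq_zero measurableSet_Ioo.nullMeasurableSet
      (fracIn_subset l ω) ?_
    filter_upwards [(ae_restrict_iff' measurableSet_Ioo).1 (h2 l)] with s hz hm
    rw [(hz hm.1 fun h => hm.2 ⟨hm.1, h⟩).2, mul_zero]

theorem cForm_eq_setIntegral (hω : MeasurableSet ω) (hs : ω ⊆ P.Ω) (i : Fin P.N) {y : P.X}
    (hy : P.restr ω y = y) (x : P.X) :
    cForm i x y = (∫ z in ω, P.c i z * val x z * val y z) +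
      ∑ l, ∫ s in P.fracIn l ω, P.cF l i s * fval x l s * fval y l s := by
  obtain ⟨h1, h2⟩ := ae_eq_zero_of_restr_eq_self hω hy
  refine congr_arg₂ _ ?_ (Finset.sum_congr rfl fun l _ => ?_)
  · refine setIntegral_eq_of_subset_of_ae_sdiff_eq_zero measurableSet_Ω.nullMeasurableSet hs ?_
    filter_upwards [(ae_restrict_iff' measurableSet_Ω).1 h1] with z hz hm
    rw [(hz hm.1 hm.2).1, mul_zero]
  · refine setIntegral_eq_of_subset_of_ae_sdiff_eq_zero measurableSet_Ioo.nullMeasurableSet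
      (fracIn_subset l ω) ?_
    filter_upwards [(ae_restrict_iff' measurableSet_Ioo).1 (h2 l)] with s hz hm
    rw [(hz hm.1 fun h => hm.2 ⟨hm.1, h⟩).1, mul_zero]

theorem aLoc_restr_left (hω : MeasurableSet ω) (hs : ω ⊆ P.Ω) (i : Fin P.N) (x y : P.X) :
    aLoc ω i (P.restr ω x) y = aLoc ω i x y := by
  refine congr_arg₂ (· + ·) ?_ (Finset.sum_congr rfl fun l _ => ?_)
  · refine integral_congr_ae ?_
    filter_upwards [ae_restrict_mem hω, ae_restrict_of_ae_restrict_of_subset hs (grad_restr hω x)]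
      with z hz h
    rw [h, indicator_of_mem hz]
  · refine integral_congr_ae ?_
    filter_upwards [ae_restrict_mem (measurableSet_fracIn l hω),
      ae_restrict_of_ae_restrict_of_subset (fracIn_subset l ω) (fder_restr hω x l)]
      with z hz h
    rw [h, indicator_of_mem (by exact hz.2)]

theorem memLp_restrict {α F : Type*} [MeasurableSpace α] [NormedAddCommGroup F] {μ : Measure α}
    {s t : Set α} (hst : s ⊆ t) (x : Lp F 2 (μ.restrict t)) : MemLp x 2 (μ.restrict s) :=
  (Lp.memLp x).mono_measure (Measure.restrict_mono hst le_rfl)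

/-- The product rule identity, summed over matrix and fractures. Testing with `χ² x` is what makes
the first term on the right disappear for harmonic `x`. -/
theorem aLoc_mul_mul (hs : ω ⊆ P.Ω) (i : Fin P.N) {χ : Plane → ℝ}
    (hχ : P.Lip χ) (x : P.X) :
    aLoc ω i (P.mul χ x) (P.mul χ x) = aLoc ω i x (P.mul χ (P.mul χ x)) +
      ((∫ z in ω, P.κ i z * ‖gradient χ z‖ ^ 2 * val x z * val x z) +
        ∑ l, ∫ s in P.fracIn l ω,
          P.κF l i s * (deriv (χ ∘ P.path l) s) ^ 2 * fval x l s * fval x l s) := by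
  set y := P.mul χ x
  set y' := P.mul χ y
  have hm : volume.restrict ω ≤ P.μm := Measure.restrict_mono hs le_rfl
  have h1 := integral_product_energy ((essBdd_κ i).mono hm) (hχ.essBdd_gradient.mono hm)
    (memLp_restrict hs x.1) (memLp_restrict hs x.2.1) (memLp_restrict hs y'.2.1)
    (ae_mono hm (val_mul hχ x)) (ae_mono hm (grad_mul hχ x)) (ae_mono hm (grad_mul hχ y))
  have h2 : ∀ l, ∫ s in P.fracIn l ω, P.κF l i s * fder y l s * fder y l s =
      (∫ s in P.fracIn l ω, P.κF l i s * fder x l s * fder y' l s) + ∫ s in P.fracIn l ω,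
        P.κF l i s * (deriv (χ ∘ P.path l) s) ^ 2 * fval x l s * fval x l s := by
    intro l
    have hsl := fracIn_subset l ω
    have hml : volume.restrict (P.fracIn l ω) ≤ P.μf l := Measure.restrict_mono hsl le_rfl
    have := integral_product_energy ((essBdd_κF l i).mono hml) ((hχ.essBdd_deriv l).mono hml)
      (memLp_restrict hsl (x.2.2.1 l)) (memLp_restrict hsl (x.2.2.2 l))
      (memLp_restrict hsl (y'.2.2.2 l)) (ae_mono hml (fval_mul hχ x l))
      (ae_mono hml (fder_mul hχ x l)) (ae_mono hml (fder_mul hχ y l))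
    simpa only [mul_mul_eq_inner, Real.norm_eq_abs, sq_abs] using this
  simp only [aLoc, h2, Finset.sum_add_distrib]
  change (∫ z in ω, P.κ i z * inner ℝ (y.2.1 z) (y.2.1 z)) + _ = _
  rw [h1]
  ring

end Support

/-! ### Cut-off estimates on coarse regions and finite overlap. -/

namespace Coarse

variable {G : Coarse P}

theorem measurableSet_ω (j : Fin G.m) : MeasurableSet (G.ω j) := (G.isOpen_ω j).measurableSet

/-- Zero values on `Γ` come from `x`, those on `Ω \ ω_j` from `χ_j`. -/
theorem mul_mem_V0 {j : Fin G.m} {x : P.X} (hx : x ∈ G.Vloc j) : P.mul (G.χ j) x ∈ G.V0 j :=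
  mul_mem_H1 (measurableSet_ω j) (G.χ_lipschitz j)
    (fun z hz => hz.imp id fun h => G.χ_support j z h) hx

theorem mul_mem_V0_of_mem {j : Fin G.m} {x : P.X} (hx : x ∈ G.V0 j) :
    P.mul (G.χ j) x ∈ G.V0 j :=
  mul_mem_H1 (measurableSet_ω j) (G.χ_lipschitz j) (fun _ hz => Or.inl hz) hx

/-- The energy of a harmonic function times the cut-off function. -/
theorem aForm_mul_self {j : Fin G.m} {i : Fin P.N} {x : P.X} (hx : x ∈ G.Vloc j)
    (h : ∀ v ∈ G.V0 j, aLoc (G.ω j) i x v = 0) :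
    aForm i (P.mul (G.χ j) x) (P.mul (G.χ j) x) = G.sForm j i x x := by
  have hω := measurableSet_ω (G := G) j
  have h0 := mul_mem_V0 hx
  -- Multiplying by `χ_j` twice stays in `V0`, so harmonicity removes the term tested with `χ_j² x`.
  rw [aForm_eq_aLoc hω (G.ω_subset j) i (restr_eq_self hω h0),
    aLoc_mul_mul (G.ω_subset j) i (G.χ_lipschitz j), h _ (mul_mem_V0_of_mem h0), zero_add]
  rfl

/-- The ratio hypothesis is multiplied by `x²` pointwise and integrated. No harmonicity is needed,
since `cForm` contains no derivatives. -/
theorem cForm_mul_self_le {E : ℝ} (hE : G.RatioLE E) {j : Fin G.m} (i : Fin P.N) {x : P.X}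
    (hx : x ∈ G.Vloc j) :
    cForm i (P.mul (G.χ j) x) (P.mul (G.χ j) x) ≤ E * G.sForm j i x x := by
  have hω := measurableSet_ω (G := G) j
  have hs := G.ω_subset j
  have hχ : P.Lip (G.χ j) := G.χ_lipschitz j
  rw [cForm_eq_setIntegral hω hs i (restr_eq_self hω (mul_mem_V0 hx)), sForm, mul_add,
    Finset.mul_sum]
  refine add_le_add ?_ (Finset.sum_le_sum fun l _ => ?_)
  · have hm : volume.restrict (G.ω j) ≤ P.μm := Measure.restrict_mono hs le_rfl
    rw [← integral_const_mul]
    refine integral_mono_ae (((essBdd_c i).mono hm).integrable_mul (memLp_restrict hs _)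
      (memLp_restrict hs _)) (((((essBdd_κ i).mul hχ.essBdd_gradient.norm_sq).mono
        hm).integrable_mul (memLp_restrict hs _) (memLp_restrict hs _)).const_mul E) ?_
    filter_upwards [(hE j i).1, ae_mono hm (val_mul hχ x)] with z h1 h2
    rw [h2]
    have := mul_le_mul_of_nonneg_right h1 (mul_self_nonneg (val x z))
    linarith
  · have hsl := fracIn_subset l (G.ω j)
    have hm : volume.restrict (P.fracIn l (G.ω j)) ≤ P.μf l := Measure.restrict_mono hsl le_rfl
    rw [← integral_const_mul]
    have hi := (((essBdd_κF l i).mul (hχ.essBdd_deriv l).norm_sq).mono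
        hm).integrable_mul (memLp_restrict hsl (x.2.2.1 l)) (memLp_restrict hsl (x.2.2.1 l))
    simp only [Real.norm_eq_abs, sq_abs] at hi
    refine integral_mono_ae (((essBdd_cF l i).mono hm).integrable_mul (memLp_restrict hsl _)
      (memLp_restrict hsl _)) (hi.const_mul E) ?_
    filter_upwards [(hE j i).2 l, ae_mono hm (fval_mul hχ x l)] with z h1 h2
    rw [h2]
    have := mul_le_mul_of_nonneg_right h1 (mul_self_nonneg (fval x l z))
    linarith

theorem aForm_sum_le {M : ℕ} (hM : G.OverlapLE M) (i : Fin P.N) {y : Fin G.m → P.X}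
    (hy : ∀ j, P.restr (G.ω j) (y j) = y j) :
    aForm i (∑ j, y j) (∑ j, y j) ≤ M * ∑ j, aForm i (y j) (y j) := by
  simp only [aForm, aLoc, fracIn_Ω, Finset.sum_add_distrib, mul_add, mul_mul_eq_inner]
  rw [Finset.sum_comm, Finset.mul_sum (Finset.univ : Finset (Fin P.F))]
  refine add_le_add ?_ (Finset.sum_le_sum fun l _ => ?_)
  · refine integral_overlap_le (essBdd_κ i) ((ae_lo_le_κ i).mono fun z hz => P.lo_pos.le.trans hz)
      hM (fun j => Lp.memLp _) (fun j => ?_) ?_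
    · exact (ae_eq_zero_of_restr_eq_self (measurableSet_ω j) (hy j)).1.mono
        fun z hz h => (hz h).2
    · have := Lp.coeFn_fun_finsetSum Finset.univ fun j => gradL P (y j)
      rw [← map_sum] at this
      exact this
  · refine integral_overlap_le (ω := fun j => P.path l ⁻¹' G.ω j) (essBdd_κF l i)
      ((ae_lo_le_κF l i).mono fun z hz => P.lo_pos.le.trans hz)
      (fun s => hM (P.path l s)) (fun j => Lp.memLp _) (fun j => ?_) ?_
    · exact ((ae_eq_zero_of_restr_eq_self (measurableSet_ω j) (hy j)).2 l).mono
        fun z hz h => (hz h).2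
    · have := Lp.coeFn_fun_finsetSum Finset.univ fun j => fderL l (y j)
      rw [← map_sum] at this
      exact this

theorem cForm_sum_le {M : ℕ} (hM : G.OverlapLE M) (i : Fin P.N) {y : Fin G.m → P.X}
    (hy : ∀ j, P.restr (G.ω j) (y j) = y j) :
    cForm i (∑ j, y j) (∑ j, y j) ≤ M * ∑ j, cForm i (y j) (y j) := by
  simp only [cForm, Finset.sum_add_distrib, mul_add, mul_mul_eq_inner]
  rw [Finset.sum_comm, Finset.mul_sum (Finset.univ : Finset (Fin P.F))]
  refine add_le_add ?_ (Finset.sum_le_sum fun l _ => ?_)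
  · refine integral_overlap_le (essBdd_c i) ((ae_lo_le_c i).mono fun z hz => P.lo_pos.le.trans hz)
      hM (fun j => Lp.memLp _) (fun j => ?_) ?_
    · exact (ae_eq_zero_of_restr_eq_self (measurableSet_ω j) (hy j)).1.mono
        fun z hz h => (hz h).1
    · have := Lp.coeFn_fun_finsetSum Finset.univ fun j => valL P (y j)
      rw [← map_sum] at this
      exact this
  · refine integral_overlap_le (ω := fun j => P.path l ⁻¹' G.ω j) (essBdd_cF l i)
      ((ae_lo_le_cF l i).mono fun z hz => P.lo_pos.le.trans hz)
      (fun s => hM (P.path l s)) (fun j => Lp.memLp _) (fun j => ?_) ?_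
    · exact ((ae_eq_zero_of_restr_eq_self (measurableSet_ω j) (hy j)).2 l).mono
        fun z hz h => (hz h).1
    · have := Lp.coeFn_fun_finsetSum Finset.univ fun j => fvalL l (y j)
      rw [← map_sum] at this
      exact this

theorem sum_aLoc_le {M : ℕ} (hM : G.OverlapLE M) (i : Fin P.N) (x : P.X) :
    ∑ j, aLoc (G.ω j) i x x ≤ M * aForm i x x := by
  simp only [aForm, aLoc, fracIn_Ω, Finset.sum_add_distrib, mul_add, mul_mul_eq_inner]
  rw [Finset.sum_comm, Finset.mul_sum (Finset.univ : Finset (Fin P.F))]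
  refine add_le_add ?_ (Finset.sum_le_sum fun l _ => ?_)
  · have := sum_setIntegral_overlap_le (μ := P.μm)
      ((essBdd_κ i).integrable_inner (Lp.memLp x.2.1) (Lp.memLp x.2.1)) ((ae_lo_le_κ i).mono
        fun z hz => mul_nonneg (P.lo_pos.le.trans hz) real_inner_self_nonneg)
      (measurableSet_ω (G := G)) hM
    simp only [Measure.restrict_restrict (measurableSet_ω (G := G) _),
      inter_eq_left.2 (G.ω_subset _)] at this
    exact this
  · have := sum_setIntegral_overlap_le (μ := P.μf l)
      ((essBdd_κF l i).integrable_inner (Lp.memLp (x.2.2.2 l)) (Lp.memLp (x.2.2.2 l)))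
      ((ae_lo_le_κF l i).mono
        fun z hz => mul_nonneg (P.lo_pos.le.trans hz) real_inner_self_nonneg)
      (fun j => measurable_path l (measurableSet_ω (G := G) j)) fun s => hM (P.path l s)
    simp only [Measure.restrict_restrict (measurable_path l (measurableSet_ω (G := G) _)),
      inter_comm _ (Ioo 0 (P.len l))] at this
    exact this

end Coarse

end MultiContinuum

/-! ### Quadratic forms of `N`-tuples. -/

theorem IsContBilin.continuous_quadratic {X : Type*} [NormedAddCommGroup X] [NormedSpace ℝ X]
    {b : X → X → ℝ} (h : IsContBilin b) : Continuous fun x => b x x := by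
  obtain ⟨B, hB⟩ := h
  simp only [hB]
  fun_prop

theorem IsContBilin.exists_bound {X : Type*} [NormedAddCommGroup X] [NormedSpace ℝ X]
    {b : X → X → ℝ} (h : IsContBilin b) : ∃ K, 0 ≤ K ∧ ∀ x, b x x ≤ K * ‖x‖ ^ 2 := by
  obtain ⟨B, hB⟩ := h
  refine ⟨‖B‖, B.opNorm_nonneg, fun x => ?_⟩
  rw [hB, sq, ← mul_assoc]
  exact (le_abs_self _).trans (B.le_opNorm₂ x x)

namespace MultiContinuum

variable {P : MultiContinuum}

theorem isContBilin_sum_aForm :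
    IsContBilin fun x y : Fin P.N → P.X => ∑ i, aForm i (x i) (y i) :=
  IsContBilin.sum _ fun i => (isContBilin_aForm i).comp
    (ContinuousLinearMap.proj (R := ℝ) (φ := fun _ : Fin P.N => P.X) i)

theorem isContBilin_sum_cForm :
    IsContBilin fun x y : Fin P.N → P.X => ∑ i, cForm i (x i) (y i) :=
  IsContBilin.sum _ fun i => (isContBilin_cForm i).comp
    (ContinuousLinearMap.proj (R := ℝ) (φ := fun _ : Fin P.N => P.X) i)

theorem continuous_aNormSq : Continuous (aNormSq : (Fin P.N → P.X) → ℝ) :=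
  isContBilin_sum_aForm.continuous_quadratic

theorem continuous_cNormSq : Continuous (cNormSq : (Fin P.N → P.X) → ℝ) :=
  isContBilin_sum_cForm.continuous_quadratic

theorem aNormSq_nonneg (x : Fin P.N → P.X) : 0 ≤ aNormSq x :=
  Finset.sum_nonneg fun i _ => aForm_nonneg i (x i)

theorem cNormSq_nonneg (x : Fin P.N → P.X) : 0 ≤ cNormSq x :=
  Finset.sum_nonneg fun i _ => cForm_nonneg i (x i)

theorem lo_mul_pi_norm_sq_le (x : Fin P.N → P.X) :
    P.lo * ‖x‖ ^ 2 ≤ cNormSq x + aNormSq x := by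
  have hlo := P.lo_pos
  have h0 : 0 ≤ cNormSq x + aNormSq x := add_nonneg (cNormSq_nonneg x) (aNormSq_nonneg x)
  have hn : ‖x‖ ≤ √((cNormSq x + aNormSq x) / P.lo) := by
    refine (pi_norm_le_iff_of_nonneg (Real.sqrt_nonneg _)).2 fun i => ?_
    rw [Real.le_sqrt (norm_nonneg _) (by positivity), le_div_iff₀ hlo, mul_comm]
    refine (lo_mul_norm_sq_le i (x i)).trans (add_le_add ?_ ?_)
    · exact Finset.single_le_sum (f := fun i => cForm i (x i) (x i))
        (fun i _ => cForm_nonneg i (x i)) (Finset.mem_univ i)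
    · exact Finset.single_le_sum (f := fun i => aForm i (x i) (x i))
        (fun i _ => aForm_nonneg i (x i)) (Finset.mem_univ i)
  have := (Real.le_sqrt (norm_nonneg x) (by positivity)).1 hn
  rw [le_div_iff₀ hlo] at this
  linarith

/-! ### Snapshot spaces, the Dirichlet principle and spectral tails. -/

namespace Coarse

variable {G : Coarse P}

/-- Both properties hold for the snapshot functions and are closed linear conditions, so they
survive the closed span. -/
theorem mem_Vsnap {j : Fin G.m} {i : Fin P.N} {x : P.X} (hx : x ∈ G.Vsnap j i) :
    x ∈ G.Vloc j ∧ ∀ v ∈ G.V0 j, aLoc (G.ω j) i x v = 0 := by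
  obtain ⟨B, hB⟩ := isContBilin_aLoc (measurableSet_ω (G := G) j) (G.ω_subset j) i
  refine ⟨?_, fun v hv => ?_⟩
  · refine Submodule.topologicalClosure_minimal _ (Submodule.span_le.2 ?_)
      (Submodule.isClosed_topologicalClosure _) hx
    rintro ψ ⟨k, hk⟩
    exact hk.1
  · suffices H : G.Vsnap j i ≤ LinearMap.ker (B.flip v : P.X →ₗ[ℝ] ℝ) by
      rw [hB]
      exact H hx
    refine Submodule.topologicalClosure_minimal _ (Submodule.span_le.2 ?_)
      (ContinuousLinearMap.isClosed_ker (B.flip v))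
    rintro ψ ⟨k, hk⟩
    exact (hB ψ v).symm.trans (hk.2.1 v hv)

/-- Harmonic functions minimize the energy. -/
theorem aLoc_le_of_sub_mem {j : Fin G.m} {i : Fin P.N} {x u : P.X} (hx : x ∈ G.Vsnap j i)
    (h : x - P.restr (G.ω j) u ∈ G.V0 j) : aLoc (G.ω j) i x x ≤ aLoc (G.ω j) i u u := by
  have hω := measurableSet_ω (G := G) j
  have hs := G.ω_subset j
  obtain ⟨B, hB⟩ := isContBilin_aLoc hω hs i
  have h1 := (mem_Vsnap hx).2 _ h
  have h2 := (aLoc_comm _ _ _ _).trans h1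
  -- By `h1` and `h2` the energy of the difference equals the energy of the restriction of `u` minus
  -- that of `x`.
  have h3 := aLoc_nonneg hω hs i (x - P.restr (G.ω j) u)
  have h4 : aLoc (G.ω j) i u u = aLoc (G.ω j) i (P.restr (G.ω j) u) (P.restr (G.ω j) u) := by
    rw [aLoc_restr_left hω hs, aLoc_comm _ _ u (P.restr _ u), aLoc_restr_left hω hs]
  rw [h4]
  simp only [hB, map_sub, sub_apply] at h1 h2 h3 ⊢
  linarith

namespace EigenSystem

variable {j : Fin G.m} {i : Fin P.N} (S : G.EigenSystem j i)

/-- The eigenvalue equation turns `s`-orthogonality into `a`-orthogonality; beyond `n` the functions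
are zero by convention. -/
theorem aLoc_of_ne {k l : ℕ} (h : k ≠ l) : aLoc (G.ω j) i (S.φ k) (S.φ l) = 0 := by
  obtain ⟨B, hB⟩ := isContBilin_aLoc (measurableSet_ω (G := G) j) (G.ω_subset j) i
  by_cases hk : (k : ℕ∞) < S.n
  · by_cases hl : (l : ℕ∞) < S.n
    · rw [S.eigen k hk _ (S.mem l), S.orthonormal k l hk hl, if_neg h, mul_zero]
    · rw [S.eq_zero l (not_lt.1 hl), hB, map_zero]
  · rw [S.eq_zero k (not_lt.1 hk), hB, map_zero, zero_apply]

theorem sForm_of_ne {k l : ℕ} (h : k ≠ l) : G.sForm j i (S.φ k) (S.φ l) = 0 := by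
  obtain ⟨B, hB⟩ := G.isContBilin_sForm j i
  by_cases hk : (k : ℕ∞) < S.n
  · by_cases hl : (l : ℕ∞) < S.n
    · rw [S.orthonormal k l hk hl, if_neg h]
    · rw [S.eq_zero l (not_lt.1 hl), hB, map_zero]
  · rw [S.eq_zero k (not_lt.1 hk), hB, map_zero, zero_apply]

theorem mul_sForm_le {L k : ℕ} (hk : L ≤ k) {Λ : ℝ} (hΛ : Λ ≤ S.lam L) :
    Λ * G.sForm j i (S.φ k) (S.φ k) ≤ aLoc (G.ω j) i (S.φ k) (S.φ k) := by
  by_cases h : (k : ℕ∞) < S.n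
  · rw [S.eigen k h _ (S.mem k)]
    exact mul_le_mul_of_nonneg_right (hΛ.trans (S.ascending L k hk h)) (G.sForm_nonneg j i _)
  · obtain ⟨B, hB⟩ := G.isContBilin_sForm j i
    obtain ⟨B', hB'⟩ := isContBilin_aLoc (measurableSet_ω (G := G) j) (G.ω_subset j) i
    rw [S.eq_zero k (not_lt.1 h), hB, hB']
    simp

/-- The part of the local snapshot projection that the offline space misses. -/
theorem tail_estimate {L : ℕ} {Λ : ℝ} (hΛ : Λ ≤ S.lam L) {x u : P.X} {b : ℕ → ℝ}
    (hx : x ∈ G.Vsnap j i) (hu : x - P.restr (G.ω j) u ∈ G.V0 j)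
    (hb : HasSum (fun k => b k • S.φ k) x) :
    x - ∑ k ∈ Finset.range L, b k • S.φ k ∈ G.Vsnap j i ∧
      Λ * G.sForm j i (x - ∑ k ∈ Finset.range L, b k • S.φ k)
        (x - ∑ k ∈ Finset.range L, b k • S.φ k) ≤ aLoc (G.ω j) i u u := by
  have hω := measurableSet_ω (G := G) j
  refine ⟨Submodule.sub_mem _ hx (Submodule.sum_mem _ fun k _ =>
    Submodule.smul_mem _ _ (S.mem k)), (?_ : _ ≤ _).trans (aLoc_le_of_sub_mem hx hu)⟩
  obtain ⟨B, hB⟩ := G.isContBilin_sForm j i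
  obtain ⟨A, hA⟩ := isContBilin_aLoc hω (G.ω_subset j) i
  rw [hA, hB]
  refine tail_bound A B hb (fun k l h => ?_) (fun k l h => ?_) (fun k => ?_) L (fun k hk => ?_) rfl
  · rw [← hA, S.aLoc_of_ne h]
  · rw [← hB, S.sForm_of_ne h]
  · rw [← hA]
    exact aLoc_nonneg hω (G.ω_subset j) i _
  · rw [← hA, ← hB]
    exact S.mul_sForm_le hk hΛ

end EigenSystem

variable {S : ∀ j i, G.EigenSystem j i} {L : Fin G.m → Fin P.N → ℕ}

variable (S L) in
/-- The pairs of `u` and the error of its offline projection. -/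
def IsErrorPair (p : (Fin P.N → P.X) × (Fin P.N → P.X)) : Prop :=
  ∃ (r : Fin G.m → Fin P.N → P.X) (b : Fin G.m → Fin P.N → ℕ → ℝ),
    IsLocalSnap p.1 r ∧ (∀ j i, HasSum (fun k => b j i k • (S j i).φ k) (r j i)) ∧
      p.2 = offline S L b - usnap r

variable (S L) in
/-- The graph of the error of the offline projection. -/
def errorGraph : Submodule ℝ ((Fin P.N → P.X) × (Fin P.N → P.X)) where
  carrier := {p | IsErrorPair S L p}
  zero_mem' := by
    choose T hT using fun j => exists_mulL (G.χ_lipschitz j)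
    choose R hR using fun j => exists_restrL (P := P) (measurableSet_ω (G := G) j)
    refine ⟨0, 0, fun j i => ?_, fun j i => ?_, ?_⟩
    · simp [hR]
    · simp
    · ext1 i
      simp [offline, usnap, hT]
  add_mem' := by
    rintro ⟨u, y⟩ ⟨u', y'⟩ ⟨r, b, h1, h2, h3⟩ ⟨r', b', h1', h2', h3'⟩
    choose T hT using fun j => exists_mulL (G.χ_lipschitz j)
    choose R hR using fun j => exists_restrL (P := P) (measurableSet_ω (G := G) j)
    refine ⟨r + r', b + b', fun j i => ⟨?_, ?_⟩, fun j i => ?_, ?_⟩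
    · exact Submodule.add_mem _ (h1 j i).1 (h1' j i).1
    · have := Submodule.add_mem _ (h1 j i).2 (h1' j i).2
      simp only [hR] at this ⊢
      convert this using 1
      simp only [Prod.fst_add, Pi.add_apply, map_add]
      abel
    · simpa [add_smul] using (h2 j i).add (h2' j i)
    · change y + y' = _
      change y = _ at h3
      change y' = _ at h3'
      rw [h3, h3']
      ext1 i
      simp only [offline, usnap, hT, Pi.add_apply, Pi.sub_apply, map_add, add_smul,
        Finset.sum_add_distrib]
      abel
  smul_mem' := by
    rintro c ⟨u, y⟩ ⟨r, b, h1, h2, h3⟩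
    choose T hT using fun j => exists_mulL (G.χ_lipschitz j)
    choose R hR using fun j => exists_restrL (P := P) (measurableSet_ω (G := G) j)
    refine ⟨c • r, c • b, fun j i => ⟨?_, ?_⟩, fun j i => ?_, ?_⟩
    · exact Submodule.smul_mem _ c (h1 j i).1
    · have := Submodule.smul_mem _ c (h1 j i).2
      simp only [hR] at this ⊢
      convert this using 1
      simp only [Prod.smul_fst, Pi.smul_apply, map_smul, smul_sub]
    · simpa [mul_smul] using (h2 j i).const_smul c
    · change c • y = _
      change y = _ at h3
      rw [h3]
      ext1 i
      simp only [offline, usnap, hT, Pi.smul_apply, Pi.sub_apply, map_smul, smul_sub,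
        Finset.smul_sum, mul_smul, smul_eq_mul]

theorem errorPair_bound {M : ℕ} (hM : G.OverlapLE M) {E : ℝ} (hE : G.RatioLE E) {Λ : ℝ}
    (hΛ0 : 0 < Λ) (hΛ : ∀ j i, Λ ≤ (S j i).lam (L j i))
    {p : (Fin P.N → P.X) × (Fin P.N → P.X)} (hp : IsErrorPair S L p) :
    cNormSq p.2 ≤ M ^ 2 * |E| / Λ * aNormSq p.1 ∧ aNormSq p.2 ≤ M ^ 2 / Λ * aNormSq p.1 := by
  obtain ⟨u, y⟩ := p
  obtain ⟨r, b, h1, h2, h3⟩ := hp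
  change y = _ at h3
  change IsLocalSnap u r at h1
  choose T hT using fun j => exists_mulL (G.χ_lipschitz j)
  set e : Fin G.m → Fin P.N → P.X :=
    fun j i => r j i - ∑ k ∈ Finset.range (L j i), b j i k • (S j i).φ k with he
  have hes : ∀ j i, e j i ∈ G.Vsnap j i ∧ Λ * G.sForm j i (e j i) (e j i) ≤
      aLoc (G.ω j) i (u i) (u i) := fun j i =>
    (S j i).tail_estimate (hΛ j i) (h1 j i).1 (h1 j i).2 (h2 j i)
  have hy : ∀ i, y i = ∑ j, P.mul (G.χ j) (-e j i) := fun i => by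
    rw [h3, Pi.sub_apply, offline, usnap, ← Finset.sum_sub_distrib]
    refine Finset.sum_congr rfl fun j _ => ?_
    simp only [hT, he, neg_sub, map_sub, map_sum, map_smul]
  have hem : ∀ j i, -e j i ∈ G.Vsnap j i := fun j i => Submodule.neg_mem _ (hes j i).1
  have hsupp : ∀ j i, P.restr (G.ω j) (P.mul (G.χ j) (-e j i)) = P.mul (G.χ j) (-e j i) :=
    fun j i => restr_eq_self (measurableSet_ω j) (mul_mem_V0 (mem_Vsnap (hem j i)).1)
  have hs : ∀ j i, G.sForm j i (-e j i) (-e j i) ≤ aLoc (G.ω j) i (u i) (u i) / Λ := fun j i => by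
    obtain ⟨B, hB⟩ := G.isContBilin_sForm j i
    rw [le_div_iff₀ hΛ0, mul_comm]
    refine le_of_eq_of_le ?_ (hes j i).2
    simp [hB]
  have hsum : ∀ i, ∑ j, G.sForm j i (-e j i) (-e j i) ≤ M * aForm i (u i) (u i) / Λ := fun i => by
    refine (Finset.sum_le_sum fun j _ => hs j i).trans ?_
    rw [← Finset.sum_div]
    exact div_le_div_of_nonneg_right (sum_aLoc_le hM i (u i)) hΛ0.le
  have hM0 : (0 : ℝ) ≤ M := Nat.cast_nonneg M
  refine ⟨?_, ?_⟩
  · rw [cNormSq, aNormSq, Finset.mul_sum]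
    refine Finset.sum_le_sum fun i _ => ?_
    change cForm i (y i) (y i) ≤ _ * aForm i (u i) (u i)
    rw [hy]
    calc _ ≤ M * ∑ j, cForm i (P.mul (G.χ j) (-e j i)) (P.mul (G.χ j) (-e j i)) :=
          cForm_sum_le hM i fun j => hsupp j i
      _ ≤ M * ∑ j, |E| * G.sForm j i (-e j i) (-e j i) := by
          refine mul_le_mul_of_nonneg_left (Finset.sum_le_sum fun j _ => ?_) hM0
          exact (cForm_mul_self_le hE i (mem_Vsnap (hem j i)).1).trans
            (mul_le_mul_of_nonneg_right (le_abs_self E) (G.sForm_nonneg j i _))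
      _ ≤ M * (|E| * (M * aForm i (u i) (u i) / Λ)) := by
          rw [← Finset.mul_sum]
          exact mul_le_mul_of_nonneg_left (mul_le_mul_of_nonneg_left (hsum i) (abs_nonneg E)) hM0
      _ = _ := by ring
  · rw [aNormSq, aNormSq, Finset.mul_sum]
    refine Finset.sum_le_sum fun i _ => ?_
    change aForm i (y i) (y i) ≤ _ * aForm i (u i) (u i)
    rw [hy]
    calc _ ≤ M * ∑ j, aForm i (P.mul (G.χ j) (-e j i)) (P.mul (G.χ j) (-e j i)) :=
          aForm_sum_le hM i fun j => hsupp j i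
      _ = M * ∑ j, G.sForm j i (-e j i) (-e j i) := by
          congr 1
          exact Finset.sum_congr rfl fun j _ =>
            aForm_mul_self (mem_Vsnap (hem j i)).1 (mem_Vsnap (hem j i)).2
      _ ≤ M * (M * aForm i (u i) (u i) / Λ) := mul_le_mul_of_nonneg_left (hsum i) hM0
      _ = _ := by ring

theorem Lambda_le (S : ∀ j i, G.EigenSystem j i) (L : Fin G.m → Fin P.N → ℕ) (j : Fin G.m)
    (i : Fin P.N) : Lambda S L ≤ (S j i).lam (L j i) :=
  ciInf_le (f := fun p : Fin G.m × Fin P.N => (S p.1 p.2).lam (L p.1 p.2))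
    (Set.finite_range _).bddBelow (j, i)

end Coarse

end MultiContinuum

open MultiContinuum in
theorem theorem1 (M : ℕ) (E : ℝ) :
    ∃ C : ℝ, 0 < C ∧
      ∀ (P : MultiContinuum) (G : Coarse P) (_ : G.OverlapLE M) (_ : G.RatioLE E)
        (S : ∀ j i, G.EigenSystem j i) (L : Fin G.m → Fin P.N → ℕ)
        (_ : ∀ j i, (L j i : ℕ∞) < (S j i).n) (_ : 0 < Coarse.Lambda S L)
        (_ : ∃ D : ℝ, ∀ v : Fin P.N → P.X, (∀ i, v i ∈ P.H10) → -qForm v v ≤ D * aNormSq v)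
        (T : ℝ) (_ : 0 < T) (f : ℝ → Fin P.N → Lp ℝ 2 P.μm) (u du : ℝ → Fin P.N → P.X)
        (_ : IsReference T f u du)
        (r : ℝ → Fin G.m → Fin P.N → P.X) (_ : ∀ t ∈ Icc 0 T, Coarse.IsLocalSnap (u t) (r t))
        (b : ℝ → Fin G.m → Fin P.N → ℕ → ℝ)
        (_ : ∀ t ∈ Icc 0 T, ∀ j i, HasSum (fun k => b t j i k • (S j i).φ k) (r t j i)),
        (∀ t ∈ Icc 0 T, ∀ i, Coarse.offline S L (b t) i ∈ Coarse.VH S L i) ∧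
        ∃ d : ℝ → Fin P.N → P.X,
          IsTimeDeriv T (fun t => Coarse.offline S L (b t) - Coarse.usnap (r t)) d ∧
          (∫ t in (0 : ℝ)..T, cNormSq (d t)) +
              (∫ t in (0 : ℝ)..T, aNormSq (Coarse.offline S L (b t) - Coarse.usnap (r t))) +
              cNormSq (Coarse.offline S L (b 0) - Coarse.usnap (r 0)) ≤
            C / Coarse.Lambda S L *
              ((∫ t in (0 : ℝ)..T, aNormSq (du t)) + (∫ t in (0 : ℝ)..T, aNormSq (u t)) +
                aNormSq (u 0)) := by
  refine ⟨M ^ 2 * (1 + |E|) + 1, by positivity, ?_⟩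
  intro P G hM hE S L _ hΛ0 _ T hT f u du hu r hr b hb
  refine ⟨fun t _ i => Submodule.sum_mem _ fun j _ => Submodule.sum_mem _ fun k hk =>
    Submodule.smul_mem _ _ (Submodule.subset_span ⟨j, k, Finset.mem_range.1 hk, rfl⟩), ?_⟩
  obtain ⟨-, ⟨hdu, hut⟩, -⟩ := hu
  set Λ := Coarse.Lambda S L
  set C : ℝ := M ^ 2 * (1 + |E|) + 1
  have hC : 0 ≤ C / Λ := by positivity
  have hbound : ∀ p ∈ Coarse.errorGraph S L,
      cNormSq p.2 ≤ C / Λ * aNormSq p.1 ∧ aNormSq p.2 ≤ C / Λ * aNormSq p.1 := by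
    intro p hp
    have hE0 := abs_nonneg E
    have hM2 : (0 : ℝ) ≤ M ^ 2 := by positivity
    obtain ⟨h1, h2⟩ := Coarse.errorPair_bound hM hE hΛ0 (Coarse.Lambda_le S L) hp
    refine ⟨h1.trans ?_, h2.trans ?_⟩ <;>
      refine mul_le_mul_of_nonneg_right (div_le_div_of_nonneg_right ?_ hΛ0.le) (aNormSq_nonneg _)
      <;> nlinarith [mul_nonneg hM2 hE0]
  obtain ⟨K, hK0, hK⟩ := (isContBilin_sum_aForm (P := P)).exists_bound
  have hlo := P.lo_pos
  obtain ⟨d, hd, hyd, hcl⟩ := exists_deriv_of_graph (G := Coarse.errorGraph S L)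
    (K := √(2 * (C / Λ) * K / P.lo)) (fun p hp => by
      rw [← Real.sqrt_sq (norm_nonneg p.1), ← Real.sqrt_mul (by positivity)]
      refine Real.le_sqrt_of_sq_le ?_
      rw [div_mul_eq_mul_div, le_div_iff₀ hlo]
      have h1 := lo_mul_pi_norm_sq_le p.2
      obtain ⟨h2, h3⟩ := hbound p hp
      have h4 := mul_le_mul_of_nonneg_left (hK p.1) hC
      change C / Λ * aNormSq p.1 ≤ _ at h4
      linarith)
    hT hdu hut (y := fun t => Coarse.offline S L (b t) - Coarse.usnap (r t))
    fun t ht => ⟨r t, b t, hr t ht, hb t ht, rfl⟩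
  refine ⟨d, ⟨hd, hyd⟩, ?_⟩
  have hdc : ∀ᵐ t ∂volume.restrict (Ioc 0 T), cNormSq (d t) ≤ C / Λ * aNormSq (du t) := by
    filter_upwards [hcl] with t ht
    have hc : IsClosed {p : (Fin P.N → P.X) × (Fin P.N → P.X) |
        cNormSq p.2 ≤ C / Λ * aNormSq p.1} :=
      isClosed_le (continuous_cNormSq.comp continuous_snd)
        (continuous_const.mul (continuous_aNormSq.comp continuous_fst))
    exact closure_minimal (fun p hp => (hbound p hp).1) hc ht
  have hgraph : ∀ t ∈ Icc 0 T,
      (u t, Coarse.offline S L (b t) - Coarse.usnap (r t)) ∈ Coarse.errorGraph S L :=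
    fun t ht => ⟨r t, b t, hr t ht, hb t ht, rfl⟩
  have hdui : Integrable (fun t => aNormSq (du t)) (volume.restrict (Ioc 0 T)) := by
    refine ((hdu.integrable_norm_pow two_ne_zero).const_mul K).mono'
      (continuous_aNormSq.comp_aestronglyMeasurable hdu.1) (.of_forall fun t => ?_)
    rw [Real.norm_of_nonneg (aNormSq_nonneg _)]
    exact hK (du t)
  have hui : Integrable (fun t => aNormSq (u t)) (volume.restrict (Ioc 0 T)) := by
    have hint : IntervalIntegrable du volume 0 T := by
      rw [intervalIntegrable_iff_integrableOn_Ioc_of_le hT.le]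
      exact hdu.integrable (by norm_num)
    have hcont : ContinuousOn u (Icc 0 T) := by
      have := intervalIntegral.continuousOn_primitive_interval' hint left_mem_uIcc
      rw [uIcc_of_le hT.le] at this
      exact (continuousOn_const.add this).congr hut
    exact ((continuous_aNormSq.comp_continuousOn hcont).integrableOn_Icc).mono_set
      Ioc_subset_Icc_self
  simp only [intervalIntegral.integral_of_le hT.le]
  rw [mul_add, mul_add]
  refine add_le_add (add_le_add ?_ ?_) (hbound _ (hgraph 0 (left_mem_Icc.2 hT.le))).1
  · rw [← integral_const_mul]
    exact integral_mono_of_nonneg (.of_forall fun t => cNormSq_nonneg _) (hdui.const_mul _) hdc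
  · rw [← integral_const_mul]
    refine integral_mono_of_nonneg (.of_forall fun t => aNormSq_nonneg _) (hui.const_mul _) ?_
    filter_upwards [ae_restrict_mem measurableSet_Ioc] with t ht
    exact (hbound _ (hgraph t (Ioc_subset_Icc_self ht))).2
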